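/- **Mesh-robust $L^2$ convergence of the variable-step BDF3 scheme.** *The formula.* For $x,y\ge 0$ let $$d_0(x,y)=\frac{1+2x}{1+x}+\frac{xy}{1+y+xy},\qquad d_2(x,y)=\frac{xy^2}{1+y+xy}\,\frac{1+x}{1+y},\qquad d_1(x,y)=-\frac{x}{1+x}-\frac{xy}{1+y+xy}-d_2(x,y),$$ and let $R_e\approx 1.4877$ be the unique positive root of $d_1(R,0)+\tfrac{7}{10}\sqrt{R}\,d_2(R,R)=0$. For a mesh $0=t_0<t_1<\dots<t_N=T$ put $\tau_k=t_k-t_{k-1}$, $\tau=\max_{1\le k\le N}\tau_k$, $r_k=\tau_k/\tau_{k-1}$ $(2\le k\le N)$. For a sequence $(v^n)$ put $\partial_\tau v^n=(v^n-v^{n-1})/\tau_n$ and, for $n\ge 3$, $$D_3v^n=d^{(n)}_0\,\partial_\tau v^n+d^{(n)}_1\,\partial_\tau v^{n-1}+d^{(n)}_2\,\partial_\tau v^{n-2},\qquad d^{(n)}_j=d_j(r_n,r_{n-1})\ (j=0,1,2),\quad d^{(n)}_j=0\ (j\ge 3).$$ The discrete orthogonal convolution (DOC) kernels are $\vartheta^{(n)}_0=1/d^{(n)}_0$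 and $\vartheta^{(n)}_{n-j}=-\frac{1}{d^{(j)}_0}\sum_{i=j+1}^{n}\vartheta^{(n)}_{n-i}d^{(i)}_{i-j}$ for $3\le j\le n-1$. Call a mesh admissible if $0<r_k<R_e$ for $2\le k\le N$. *The problem.* Let $\Omega\subset\mathbb R^d$ be a bounded convex open set, $T>0$, $\varepsilon>0$, $\kappa^*>0$, let $\kappa$ be smooth on $\Omega$ with $|\kappa|\le\kappa^*$, and let $\|\cdot\|$ be the norm of $L^2(\Omega)$. Let $u$ solve $$\partial_tu-\varepsilon\Delta u=\kappa u+f\ \text{ in }\Omega,\ 0<t\le T,\qquad u=0\ \text{on }\partial\Omega,\qquad u(0)=u_0,$$ where $u$ is assumed smooth in time, $u\in C^4([0,T];L^2(\Omega))$; the boundary condition means $u(t)\in H^1_0(\Omega)$, and $\Delta u(t)\in L^2(\Omega)$ is the weak Laplacian. Let $u^0,u^1,u^2\in L^2(\Omega)$ be arbitrary starting values and let $u^k\in H^1_0(\Omega)$, with weak Laplacian $\Delta u^k\in L^2(\Omega)$, satisfy $$D_3u^k=\varepsilon\Delta u^k+\kappa u^k+f(t_k,\cdot),\qquad 3\le k\le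 N.$$ Write $\tilde u^n=u(t_n)-u^n$. **Theorem.** There is an absolute constant $K_3>0$ such that, for every admissible mesh, $$\sum_{j=3}^{n}|\vartheta^{(n)}_{n-j}|\le K_3\quad(3\le n\le N),\qquad \sum_{j=i}^{n}|\vartheta^{(j)}_{j-i}|\le K_3\quad(3\le i\le n\le N),$$ and such that the following holds. For every $\Omega$, $T$ and $u\in C^4([0,T];L^2(\Omega))$ as above there is a constant $K_u>0$, depending only on these (in particular not on $\varepsilon,\kappa,\kappa^*,f$, nor on the mesh, its step sizes or its step ratios), such that on every admissible mesh the truncation error satisfies $$\|D_3u(t_j)-\partial_tu(t_j)\|\le K_u\tau^3\qquad(3\le j\le N),$$ and, whenever $u$ solves the problem above and $\tau\le 1/(4K_3\kappa^*)$, $$\|\tilde u^n\|\le 2\exp(4K_3\kappa^*t_{n-1})\Big(\|\tilde u^2\|+K_3\tau\|\partial_\tau\tilde u^1\|+4K_3\tau\|\partial_\tau\tilde u^2\|+2K_3K_u\,t_n\,\tau^3\Big)\qquad(3\le n\le N).$$ -/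

import Mathlib

open MeasureTheory Filter Topology Set
open scoped Distributions ContDiff

noncomputable section

namespace BDF3

/-! ### The variable-step BDF3 formula -/

/-- The coefficient function `d₀(x, y)`. -/
def d0 (x y : ℝ) : ℝ := (1 + 2 * x) / (1 + x) + x * y / (1 + y + x * y)

/-- The coefficient function `d₁(x, y)`. -/
def d1 (x y : ℝ) : ℝ :=
  -(x / (1 + x)) - x * y / (1 + y + x * y)
    - x * y ^ 2 / (1 + y + x * y) * ((1 + x) / (1 + y))

/-- The coefficient function `d₂(x, y)`. -/
def d2 (x y : ℝ) : ℝ := x * y ^ 2 / (1 + y + x * y) * ((1 + x) / (1 + y))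

/-- The function of `R` whose unique positive zero is the step-ratio limit, in closed form. -/
theorem limit_fun_eq {R : ℝ} (hR : 0 < R) :
    d1 R 0 + 7 / 10 * Real.sqrt R * d2 R R =
      R * (7 / 10 * (Real.sqrt R * (R ^ 2 / (1 + R + R ^ 2))) - 1 / (1 + R)) := by
  have h1 : (1 + R) ≠ 0 := by positivity
  have h2 : (1 + R + R ^ 2) ≠ 0 := by positivity
  have h3 : (1 + R + R * R) ≠ 0 := by positivity
  unfold d1 d2
  field_simp
  ring

/-- The equation `d₁(R, 0) + (7/10) √R d₂(R, R) = 0` has exactly one positive root. -/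
theorem existsUnique_limit :
    ∃! R : ℝ, 0 < R ∧ d1 R 0 + 7 / 10 * Real.sqrt R * d2 R R = 0 := by
  have hzero : ∀ R : ℝ, 0 < R → (d1 R 0 + 7 / 10 * Real.sqrt R * d2 R R = 0 ↔
      7 / 10 * (Real.sqrt R * (R ^ 2 / (1 + R + R ^ 2))) - 1 / (1 + R) = 0) := by
    intro R hR
    rw [limit_fun_eq hR, mul_eq_zero]
    exact ⟨fun h => h.resolve_left hR.ne', Or.inr⟩
  have hmono : ∀ R S : ℝ, 0 < R → R < S →
      7 / 10 * (Real.sqrt R * (R ^ 2 / (1 + R + R ^ 2))) - 1 / (1 + R) <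
        7 / 10 * (Real.sqrt S * (S ^ 2 / (1 + S + S ^ 2))) - 1 / (1 + S) := by
    intro R S hR hRS
    have hS : 0 < S := hR.trans hRS
    have a1 : Real.sqrt R ≤ Real.sqrt S := Real.sqrt_le_sqrt hRS.le
    have a2 : R ^ 2 / (1 + R + R ^ 2) ≤ S ^ 2 / (1 + S + S ^ 2) := by
      rw [div_le_div_iff₀ (by positivity) (by positivity)]
      have : 0 ≤ (S - R) * (R + S + R * S) :=
        mul_nonneg (by linarith) (by positivity)
      nlinarith
    have a3 : 1 / (1 + S) < 1 / (1 + R) :=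
      one_div_lt_one_div_of_lt (by linarith) (by linarith)
    have a4 := mul_le_mul a1 a2 (by positivity) (Real.sqrt_nonneg S)
    linarith
  have hcont : ContinuousOn (fun R : ℝ =>
      7 / 10 * (Real.sqrt R * (R ^ 2 / (1 + R + R ^ 2))) - 1 / (1 + R)) (Icc 1 4) := by
    refine ContinuousOn.sub (ContinuousOn.mul continuousOn_const
      (ContinuousOn.mul Real.continuous_sqrt.continuousOn
        (ContinuousOn.div (by fun_prop) (by fun_prop) ?_)))
      (ContinuousOn.div (by fun_prop) (by fun_prop) ?_)
    · intro x hx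
      have : (0 : ℝ) < x := lt_of_lt_of_le one_pos hx.1
      positivity
    · intro x hx
      have : (0 : ℝ) < x := lt_of_lt_of_le one_pos hx.1
      positivity
  have h4 : Real.sqrt 4 = 2 := by
    rw [show (4 : ℝ) = 2 ^ 2 by norm_num, Real.sqrt_sq (by norm_num)]
  obtain ⟨R, hR, hR0⟩ := intermediate_value_Icc (by norm_num : (1 : ℝ) ≤ 4) hcont
    (show (0 : ℝ) ∈ Icc _ _ from ⟨by norm_num, by rw [h4]; norm_num⟩)
  have hRpos : 0 < R := lt_of_lt_of_le one_pos hR.1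
  refine ⟨R, ⟨hRpos, (hzero R hRpos).2 hR0⟩, ?_⟩
  rintro S ⟨hS, hS0⟩
  have hS0' := (hzero S hS).1 hS0
  simp only at hR0
  rcases lt_trichotomy S R with h | h | h
  · have := hmono S R hS h
    linarith
  · exact h
  · have := hmono R S hRpos h
    linarith

/-- The step-ratio limit `R_e ≈ 1.4877`: the unique positive root of
`d₁(R, 0) + (7/10) √R d₂(R, R) = 0`. -/
def stepRatioLimit : ℝ := existsUnique_limit.choose

theorem stepRatioLimit_spec : 0 < stepRatioLimit ∧
    d1 stepRatioLimit 0 + 7 / 10 * Real.sqrt stepRatioLimit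
      * d2 stepRatioLimit stepRatioLimit = 0 :=
  existsUnique_limit.choose_spec.1

/-- `0 = t₀ < t₁ < ⋯ < t_N = T`. Only the values `t k` with `k ≤ N` matter. -/
structure IsMesh (T : ℝ) (N : ℕ) (t : ℕ → ℝ) : Prop where
  zero : t 0 = 0
  last : t N = T
  lt : ∀ k < N, t k < t (k + 1)

/-- The step size `τ_k = t_k - t_{k-1}`, for `k ≥ 1`. -/
def step (t : ℕ → ℝ) (k : ℕ) : ℝ := t k - t (k - 1)

/-- The adjacent step ratio `r_k = τ_k / τ_{k-1}`, for `k ≥ 2`. -/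
def ratio (t : ℕ → ℝ) (k : ℕ) : ℝ := step t k / step t (k - 1)

/-- The maximum step size `τ = max_{1 ≤ k ≤ N} τ_k`. -/
def maxStep (t : ℕ → ℝ) (N : ℕ) : ℝ := sSup (step t '' Icc 1 N)

/-- All step ratios satisfy `0 < r_k < R_e`, `2 ≤ k ≤ N`. -/
def RatiosAdmissible (t : ℕ → ℝ) (N : ℕ) : Prop :=
  ∀ k, 2 ≤ k → k ≤ N → 0 < ratio t k ∧ ratio t k < stepRatioLimit

/-- The difference quotient `∂_τ vⁿ = (vⁿ - vⁿ⁻¹) / τ_n`, for `n ≥ 1`. -/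
def diffQuot {V : Type*} [AddCommGroup V] [Module ℝ V] (t : ℕ → ℝ) (v : ℕ → V) (n : ℕ) : V :=
  (step t n)⁻¹ • (v n - v (n - 1))

/-- The discrete BDF3 kernels `d_j^{(n)}`, for `n ≥ 3`. -/
def kernel (t : ℕ → ℝ) (n : ℕ) : ℕ → ℝ
  | 0 => d0 (ratio t n) (ratio t (n - 1))
  | 1 => d1 (ratio t n) (ratio t (n - 1))
  | 2 => d2 (ratio t n) (ratio t (n - 1))
  | _ + 3 => 0

/-- The variable-step BDF3 formula
`D₃vⁿ = d₀^{(n)} ∂_τ vⁿ + d₁^{(n)} ∂_τ vⁿ⁻¹ + d₂^{(n)} ∂_τ vⁿ⁻²`, for `n ≥ 3`. -/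
def D3 {V : Type*} [AddCommGroup V] [Module ℝ V] (t : ℕ → ℝ) (v : ℕ → V) (n : ℕ) : V :=
  kernel t n 0 • diffQuot t v n + kernel t n 1 • diffQuot t v (n - 1)
    + kernel t n 2 • diffQuot t v (n - 2)

/-- The discrete orthogonal convolution (DOC) kernels: `docKernel t n m` is `ϑ_m^{(n)}`, for
`m ≤ n - 3`, given by `ϑ_0^{(n)} = 1 / d_0^{(n)}` and, with `j = n - m`,
`ϑ_{n-j}^{(n)} = -(1 / d_0^{(j)}) ∑_{i=j+1}^{n} ϑ_{n-i}^{(n)} d_{i-j}^{(i)}`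
(the summation index below is `l = n - i`). -/
def docKernel (t : ℕ → ℝ) (n : ℕ) : ℕ → ℝ
  | 0 => 1 / kernel t n 0
  | m + 1 => -(1 / kernel t (n - (m + 1)) 0) *
      ∑ l : Fin (m + 1), docKernel t n l.val * kernel t (n - l.val) (m + 1 - l.val)
  decreasing_by exact l.isLt

/-- `K` bounds all row and column sums of absolute values of the DOC kernels of the mesh. -/
def IsDocBound (t : ℕ → ℝ) (N : ℕ) (K : ℝ) : Prop :=
  ∀ n, 3 ≤ n → n ≤ N →
    (∑ j ∈ Finset.Icc 3 n, |docKernel t n (n - j)| ≤ K) ∧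
    ∀ i, 3 ≤ i → i ≤ n → ∑ j ∈ Finset.Icc i n, |docKernel t j (j - i)| ≤ K

/-! ### The reaction-diffusion problem and its time discretization -/

/-- The Euclidean space `ℝᵈ`. -/
abbrev E (d : ℕ) : Type := EuclideanSpace ℝ (Fin d)

/-- The space `L²(Ω)`; its norm is the `L²` norm. -/
abbrev L2 {d : ℕ} (Ω : TopologicalSpace.Opens (E d)) : Type :=
  Lp ℝ 2 (volume.restrict (Ω : Set (E d)))

/-- The space `L²(Ω)ᵈ` of square integrable vector fields. -/
abbrev L2Vec {d : ℕ} (Ω : TopologicalSpace.Opens (E d)) : Type :=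
  Lp (E d) 2 (volume.restrict (Ω : Set (E d)))

/-- `v ∈ H¹₀(Ω)` with weak gradient `g`: the function `v` is the `H¹` limit of test functions
`φ_m ∈ C_c^∞(Ω)`, that is, `φ_m → v` and `∇φ_m → g` in `L²`. -/
def HasH10Gradient {d : ℕ} (Ω : TopologicalSpace.Opens (E d)) (v : L2 Ω) (g : L2Vec Ω) : Prop :=
  ∃ φ : ℕ → 𝓓(Ω, ℝ),
    Tendsto (fun m => eLpNorm (fun x => φ m x - v x) 2 (volume.restrict (Ω : Set (E d))))
      atTop (𝓝 0) ∧
    Tendsto (fun m => eLpNorm (fun x => gradient (φ m) x - g x) 2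
      (volume.restrict (Ω : Set (E d)))) atTop (𝓝 0)

/-- `v ∈ H¹₀(Ω)` (homogeneous Dirichlet boundary condition) and `Δv = w ∈ L²(Ω)` in the weak
sense: `∫_Ω ∇v · ∇φ = -∫_Ω w φ` for all `φ ∈ C_c^∞(Ω)`. -/
def HasDirichletLaplacian {d : ℕ} (Ω : TopologicalSpace.Opens (E d)) (v w : L2 Ω) : Prop :=
  ∃ g : L2Vec Ω, HasH10Gradient Ω v g ∧
    ∀ φ : 𝓓(Ω, ℝ), ∫ x in (Ω : Set (E d)), inner ℝ (g x) (gradient φ x) =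
      -∫ x in (Ω : Set (E d)), w x * φ x

/-- `u` solves `∂_t u - ε Δu = κ u + f` on `Ω × (0, T]` with homogeneous Dirichlet boundary
condition and `u(0) = u₀`; the time derivative is the one of the curve `u : [0, T] → L²(Ω)`. -/
structure IsSolution {d : ℕ} (Ω : TopologicalSpace.Opens (E d)) (T ε : ℝ) (κ : E d → ℝ)
    (f : ℝ → E d → ℝ) (u₀ : L2 Ω) (u : ℝ → L2 Ω) : Prop where
  initial : u 0 = u₀
  differentiable : DifferentiableOn ℝ u (Icc 0 T)
  pde : ∀ s ∈ Ioc 0 T, ∃ w : L2 Ω, HasDirichletLaplacian Ω (u s) w ∧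
    ∀ᵐ x ∂(volume.restrict (Ω : Set (E d))),
      (derivWithin u (Icc 0 T) s) x - ε * w x = κ x * (u s) x + f s x

/-- `U` satisfies the BDF3 time-stepping scheme `D₃Uᵏ = ε ΔUᵏ + κ Uᵏ + f(t_k)`, with
`Uᵏ = 0` on `∂Ω`, for `3 ≤ k ≤ N`. The starting values `U⁰, U¹, U²` are arbitrary. -/
def IsBDF3Solution {d : ℕ} (Ω : TopologicalSpace.Opens (E d)) (ε : ℝ) (κ : E d → ℝ)
    (f : ℝ → E d → ℝ) (t : ℕ → ℝ) (N : ℕ) (U : ℕ → L2 Ω) : Prop :=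
  ∀ k, 3 ≤ k → k ≤ N → ∃ w : L2 Ω, HasDirichletLaplacian Ω (U k) w ∧
    ∀ᵐ x ∂(volume.restrict (Ω : Set (E d))),
      (D3 t U k) x = ε * w x + κ x * (U k) x + f (t k) x

/-- The solution error `ũⁿ = u(t_n) - uⁿ`. -/
def err {V : Type*} [AddCommGroup V] (u : ℝ → V) (t : ℕ → ℝ) (U : ℕ → V) (n : ℕ) : V :=
  u (t n) - U n

end BDF3

end

/-! The argument needs only `stepRatioLimit < 3 / 2`. All coefficient estimates are made for step
ratios in `[0, 3/2]` (`RatiosBounded`), where they reduce to polynomial inequalities.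

Kernel sums. The DOC kernels form the inverse of the BDF3 convolution, so for fixed `i` the sequence
`docKernel t n (n - i)` in `n` is its response to a unit impulse at `i`
(`docKernel_eq_kernelSolve`). Past the impulse it obeys the homogeneous three-term recursion, which
contracts one fixed quadratic form by `81/100` at every step, whatever the ratios (`lyapunov_step`).
Hence the kernels are at most `2 * (9/10)^(n - i)`, and row and column sums are bounded by a
geometric series.

Stability. Weighted by the step sizes, the DOC kernels are positive semidefinite: a quadratic
storage function certifies this, its increment being dominated by `τ_k ⟨z_k, (d * z)_k⟩`
(`storage_decrease`). Convolving the error equation with the DOC kernels turns `D₃` into a single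
difference quotient plus starting terms. Tested with the error, the diffusion term is minus a Gram
form of gradients and has a favourable sign, so `ε` disappears. Evaluating at an index of maximal
error removes one power of the norm, and a discrete Grönwall inequality finishes
(`norm_le_of_isErrorEquation`).

Consistency. The formula is exact on cubic polynomials in time, and its coefficients are uniformly
bounded. A Taylor expansion of `u'` about `t_{j-3}` therefore gives a third-order error uniform in
the mesh (`exists_truncation_bound`). -/

noncomputable section

namespace BDF3

/-! ### Coefficient inequalities on the square `[0, 3/2]²` and contraction of the homogeneous
recursion -/

theorem discriminant_poly_nonneg {x y : ℝ} (hx : 0 ≤ x) (hx' : x ≤ 3 / 2) (hy : 0 ≤ y)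
    (hy' : y ≤ 3 / 2) : 0 ≤
      20 + 71 * y + 84 * y ^ 2 + 26 * y ^ 3 + (-16) * y ^ 4 + (-9) * y ^ 5 + 204 * x + 948 * x * y
      + 1404 * x * y ^ 2 + 564 * x * y ^ 3 + (-312) * x * y ^ 4 + (-216) * x * y ^ 5 + 268 * x ^ 2
      + 1901 * x ^ 2 * y + 3940 * x ^ 2 * y ^ 2 + 2565 * x ^ 2 * y ^ 3 + (-426) * x ^ 2 * y ^ 4
      + (-684) * x ^ 2 * y ^ 5 + (-16) * x ^ 3 + 712 * x ^ 3 * y + 2728 * x ^ 3 * y ^ 2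
      + 2480 * x ^ 3 * y ^ 3 + (-256) * x ^ 3 * y ^ 4 + (-611) * x ^ 3 * y ^ 5
      + (-112) * x ^ 4 * y + (-68) * x ^ 4 * y ^ 2 + (-399) * x ^ 4 * y ^ 3
      + (-672) * x ^ 4 * y ^ 4 + 271 * x ^ 4 * y ^ 5 + (-276) * x ^ 5 * y ^ 2
      + (-1132) * x ^ 5 * y ^ 3 + (-916) * x ^ 5 * y ^ 4 + 690 * x ^ 5 * y ^ 5
      + (-280) * x ^ 6 * y ^ 3 + (-470) * x ^ 6 * y ^ 4 + 310 * x ^ 6 * y ^ 5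
      + (-100) * x ^ 7 * y ^ 4 + 25 * x ^ 7 * y ^ 5 := by
  -- A Bernstein-type certificate: with `3 = u + 2x = v + 2y`, homogenizing to degree 7 in `(x, u)`
  -- and degree 5 in `(y, v)` multiplies the polynomial by `3 ^ 12 = 531441` and makes every
  -- coefficient positive.
  have key : ∀ u v : ℝ, 0 ≤ u → 0 ≤ v → 0 ≤
      20 * u ^ 7 * v ^ 5 + 413 * u ^ 7 * y * v ^ 4 + 3260 * u ^ 7 * y ^ 2 * v ^ 3
      + 11950 * u ^ 7 * y ^ 3 * v ^ 2 + 19000 * u ^ 7 * y ^ 4 * v + 8125 * u ^ 7 * y ^ 5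
      + 892 * x * u ^ 6 * v ^ 5 + 20434 * x * u ^ 6 * y * v ^ 4
      + 176284 * x * u ^ 6 * y ^ 2 * v ^ 3 + 694160 * x * u ^ 6 * y ^ 3 * v ^ 2
      + 1149800 * x * u ^ 6 * y ^ 4 * v + 446750 * x * u ^ 6 * y ^ 5
      + 11436 * x ^ 2 * u ^ 5 * v ^ 5 + 285963 * x ^ 2 * u ^ 5 * y * v ^ 4
      + 2667804 * x ^ 2 * u ^ 5 * y ^ 2 * v ^ 3 + 11289063 * x ^ 2 * u ^ 5 * y ^ 3 * v ^ 2
      + 20049330 * x ^ 2 * u ^ 5 * y ^ 4 * v + 8506200 * x ^ 2 * u ^ 5 * y ^ 5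
      + 66008 * x ^ 3 * u ^ 4 * v ^ 5 + 1802582 * x ^ 3 * u ^ 4 * y * v ^ 4
      + 18120800 * x ^ 3 * u ^ 4 * y ^ 2 * v ^ 3 + 81721942 * x ^ 3 * u ^ 4 * y ^ 3 * v ^ 2
      + 153262900 * x ^ 3 * u ^ 4 * y ^ 4 * v + 68847325 * x ^ 3 * u ^ 4 * y ^ 5
      + 202144 * x ^ 4 * u ^ 3 * v ^ 5 + 5993080 * x ^ 4 * u ^ 3 * y * v ^ 4
      + 64366780 * x ^ 4 * u ^ 3 * y ^ 2 * v ^ 3 + 304763387 * x ^ 4 * u ^ 3 * y ^ 3 * v ^ 2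
      + 588092780 * x ^ 4 * u ^ 3 * y ^ 4 * v + 269654225 * x ^ 4 * u ^ 3 * y ^ 5
      + 342912 * x ^ 5 * u ^ 2 * v ^ 5 + 10946928 * x ^ 5 * u ^ 2 * y * v ^ 4
      + 124004748 * x ^ 5 * u ^ 2 * y ^ 2 * v ^ 3 + 600762030 * x ^ 5 * u ^ 2 * y ^ 3 * v ^ 2
      + 1136028300 * x ^ 5 * u ^ 2 * y ^ 4 * v + 514473000 * x ^ 5 * u ^ 2 * y ^ 5
      + 305600 * x ^ 6 * u * v ^ 5 + 10414640 * x ^ 6 * u * y * v ^ 4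
      + 122444960 * x ^ 6 * u * y ^ 2 * v ^ 3 + 580278460 * x ^ 6 * u * y ^ 3 * v ^ 2
      + 949917850 * x ^ 6 * u * y ^ 4 * v + 404160250 * x ^ 6 * u * y ^ 5 + 112000 * x ^ 7 * v ^ 5
      + 4040800 * x ^ 7 * y * v ^ 4 + 48377200 * x ^ 7 * y ^ 2 * v ^ 3
      + 206418200 * x ^ 7 * y ^ 3 * v ^ 2 + 160967000 * x ^ 7 * y ^ 4 * v
      + 28608125 * x ^ 7 * y ^ 5 := by
    intro u v hu hv
    positivity
  have := key (3 - 2 * x) (3 - 2 * y) (by linarith) (by linarith)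
  have h := mul_nonneg (by norm_num : (0 : ℝ) ≤ 1/531441) this
  refine h.trans_eq ?_
  ring

/-- This is the discriminant condition for the quadratic form in `z0, z1` that remains in
`storage_decrease` after the square in `z2` has been completed. -/
theorem discriminant_nonneg {x y : ℝ} (hx : 0 ≤ x) (hx' : x ≤ 3 / 2) (hy : 0 ≤ y)
    (hy' : y ≤ 3 / 2) :
    x * (d1 x y + 3 / 5 + 3 / 4 * (y * d2 x y)) ^ 2 ≤
      4 * (d0 x y - 9 / 10 - 5 / 8 * (x * y * d2 x y ^ 2)) * (1 / 2 - 9 / 40 * y) := by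
  have h1 : (1 + x) ≠ 0 := by positivity
  have h2 : (1 + y) ≠ 0 := by positivity
  have h3 : (1 + y + x * y) ≠ 0 := by positivity
  have key : 4 * (d0 x y - 9 / 10 - 5 / 8 * (x * y * d2 x y ^ 2)) * (1 / 2 - 9 / 40 * y) -
      x * (d1 x y + 3 / 5 + 3 / 4 * (y * d2 x y)) ^ 2 = (
      20 + 71 * y + 84 * y ^ 2 + 26 * y ^ 3 + (-16) * y ^ 4 + (-9) * y ^ 5 + 204 * x + 948 * x * y
      + 1404 * x * y ^ 2 + 564 * x * y ^ 3 + (-312) * x * y ^ 4 + (-216) * x * y ^ 5 + 268 * x ^ 2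
      + 1901 * x ^ 2 * y + 3940 * x ^ 2 * y ^ 2 + 2565 * x ^ 2 * y ^ 3 + (-426) * x ^ 2 * y ^ 4
      + (-684) * x ^ 2 * y ^ 5 + (-16) * x ^ 3 + 712 * x ^ 3 * y + 2728 * x ^ 3 * y ^ 2
      + 2480 * x ^ 3 * y ^ 3 + (-256) * x ^ 3 * y ^ 4 + (-611) * x ^ 3 * y ^ 5
      + (-112) * x ^ 4 * y + (-68) * x ^ 4 * y ^ 2 + (-399) * x ^ 4 * y ^ 3
      + (-672) * x ^ 4 * y ^ 4 + 271 * x ^ 4 * y ^ 5 + (-276) * x ^ 5 * y ^ 2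
      + (-1132) * x ^ 5 * y ^ 3 + (-916) * x ^ 5 * y ^ 4 + 690 * x ^ 5 * y ^ 5
      + (-280) * x ^ 6 * y ^ 3 + (-470) * x ^ 6 * y ^ 4 + 310 * x ^ 6 * y ^ 5
      + (-100) * x ^ 7 * y ^ 4 + 25 * x ^ 7 * y ^ 5) / (100 * ((1 + x) * (1 + y) * (1 + y + x * y)) ^ 2) := by
    unfold d0 d1 d2
    field_simp
    ring
  have := div_nonneg (discriminant_poly_nonneg hx hx' hy hy')
    (by positivity : 0 ≤ 100 * ((1 + x) * (1 + y) * (1 + y + x * y)) ^ 2)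
  rw [← key] at this
  linarith

theorem stepRatioLimit_lt : stepRatioLimit < 3 / 2 := by
  obtain ⟨hpos, hzero⟩ := stepRatioLimit_spec
  set R := stepRatioLimit
  by_contra! h
  rw [limit_fun_eq hpos] at hzero
  have h0 := (mul_eq_zero.1 hzero).resolve_left hpos.ne'
  -- The number 1.224 is a rational lower bound of `√(3/2)`, sharp enough that `0.7 * 1.224 * 9/19`
  -- exceeds `2/5`.
  have a1 : (49 / 40 : ℝ) - 1 / 1000 ≤ Real.sqrt R :=
    Real.le_sqrt_of_sq_le (by norm_num; linarith)
  have a2 : (9 / 19 : ℝ) ≤ R ^ 2 / (1 + R + R ^ 2) := by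
    rw [div_le_div_iff₀ (by norm_num) (by positivity)]
    nlinarith
  have a3 : 1 / (1 + R) ≤ 2 / 5 := by
    rw [div_le_div_iff₀ (by positivity) (by norm_num)]
    linarith
  have a4 := mul_le_mul a1 a2 (by positivity) (Real.sqrt_nonneg R)
  linarith

theorem d0_add_d1_add_d2 {x y : ℝ} (hx : 0 ≤ x) (hy : 0 ≤ y) : d0 x y + d1 x y + d2 x y = 1 := by
  have h1 : (1 + x) ≠ 0 := by positivity
  have h2 : (1 + y) ≠ 0 := by positivity
  have h3 : (1 + y + x * y) ≠ 0 := by positivity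
  unfold d0 d1 d2
  field_simp
  ring

theorem one_le_d0 {x y : ℝ} (hx : 0 ≤ x) (hy : 0 ≤ y) : 1 ≤ d0 x y := by
  have h1 : 1 ≤ (1 + 2 * x) / (1 + x) := by
    rw [le_div_iff₀ (by positivity)]
    linarith
  have h2 : 0 ≤ x * y / (1 + y + x * y) := by positivity
  unfold d0
  linarith

theorem d2_nonneg {x y : ℝ} (hx : 0 ≤ x) (hy : 0 ≤ y) : 0 ≤ d2 x y := by
  unfold d2
  positivity

theorem d0_le {x y : ℝ} (hx : 0 ≤ x) (hx' : x ≤ 3 / 2) (hy : 0 ≤ y) (hy' : y ≤ 3 / 2) :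
    d0 x y ≤ 52 / 25 := by
  have h1 : (1 + 2 * x) / (1 + x) ≤ 8 / 5 := by
    rw [div_le_div_iff₀ (by positivity) (by norm_num)]
    linarith
  have h2 : x * y / (1 + y + x * y) ≤ 9 / 19 := by
    rw [div_le_div_iff₀ (by positivity) (by norm_num)]
    nlinarith
  unfold d0
  linarith

theorem d2_le_d0 {x y : ℝ} (hx : 0 ≤ x) (hx' : x ≤ 3 / 2) (hy : 0 ≤ y) (hy' : y ≤ 3 / 2) :
    d2 x y ≤ 2 / 3 * (d0 x y - 1) := by
  have h1 : (1 + x) ≠ 0 := by positivity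
  have h2 : (1 + y) ≠ 0 := by positivity
  have h3 : (1 + y + x * y) ≠ 0 := by positivity
  have key : 2 / 3 * (d0 x y - 1) - d2 x y =
      x * (2 * (1 + y) * (1 + 2 * y + 2 * x * y) - 3 * y ^ 2 * (1 + x) ^ 2) /
        (3 * (1 + x) * (1 + y) * (1 + y + x * y)) := by
    unfold d0 d2
    field_simp
    ring
  -- The bracket in `key` is a concave quadratic in `x`. This expression is `3/2` times it, written
  -- as the chord through its values at `0` and `3/2` plus the concavity term.
  have h0 : 0 ≤ (3 / 2 - x) * (2 * (1 + y) * (1 + 2 * y) - 3 * y ^ 2) +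
      x * (2 + 12 * y - 35 / 4 * y ^ 2) + 9 / 2 * x * y ^ 2 * (3 / 2 - x) := by
    have e1 : 0 ≤ 2 * (1 + y) * (1 + 2 * y) - 3 * y ^ 2 := by nlinarith
    have e2 : 0 ≤ 2 + 12 * y - 35 / 4 * y ^ 2 := by nlinarith
    have e3 : 0 ≤ 3 / 2 - x := by linarith
    positivity
  have : 0 ≤ 2 / 3 * (d0 x y - 1) - d2 x y := by
    rw [key]
    refine div_nonneg (mul_nonneg hx ?_) (by positivity)
    nlinarith
  linarith

/-- The quadratic Lyapunov function of the homogeneous BDF3 recursion. -/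
def lyapunov (a b : ℝ) : ℝ := a ^ 2 - 2 / 3 * a * b + 1 / 4 * b ^ 2

/-- The pair `(s, b)` ranges over a triangle with vertices `(0, 0)`, `(13/25, 0)` and `(13/25,
26/75)`. The left side is convex in `(s, b)`, so the bound follows from its three vertex cases. -/
theorem lyapunov_le {s b z1 z2 : ℝ} (hs : s ≤ 13 / 25) (hb : 0 ≤ b) (hbs : b ≤ 2 / 3 * s) :
    lyapunov ((s + b) * z1 - b * z2) z1 ≤ 81 / 100 * lyapunov z1 z2 := by
  -- `l1`, `l2` and `1 - l1 - l2` are the barycentric coordinates in that triangle.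
  obtain ⟨l2, hl2⟩ : ∃ l2, l2 = b * (75 / 26) := ⟨_, rfl⟩
  obtain ⟨l1, hl1⟩ : ∃ l1, l1 = s * (25 / 13) - l2 := ⟨_, rfl⟩
  have e2 : b = 26 / 75 * l2 := by rw [hl2]; ring
  have e1 : s = 13 / 25 * (l1 + l2) := by rw [hl1]; ring
  have p2 : 0 ≤ l2 := by rw [hl2]; positivity
  have p1 : 0 ≤ l1 := by linarith
  have p3 : 0 ≤ 1 - l1 - l2 := by linarith
  subst e1 e2
  have f1 : 0 ≤ 81 / 100 * lyapunov z1 z2 - lyapunov 0 z1 := by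
    unfold lyapunov
    nlinarith [sq_nonneg (z2 - 4 / 3 * z1), sq_nonneg z1]
  have f2 : 0 ≤ 81 / 100 * lyapunov z1 z2 - lyapunov (13 / 25 * z1) z1 := by
    unfold lyapunov
    nlinarith [sq_nonneg (z2 - 4 / 3 * z1), sq_nonneg z1]
  have f3 : 0 ≤ 81 / 100 * lyapunov z1 z2 -
      lyapunov (65 / 75 * z1 - 26 / 75 * z2) z1 := by
    unfold lyapunov
    nlinarith [sq_nonneg (z2 - z1), sq_nonneg z1]
  have g := add_nonneg (add_nonneg (mul_nonneg p1 f2) (mul_nonneg p2 f3)) (mul_nonneg p3 f1)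
  -- This is the Jensen gap of the square, `∑ λᵢ λⱼ (vᵢ - vⱼ)²` over pairs of vertices.
  have j : 0 ≤ l1 * l2 * (13 / 25 * z1 - (65 / 75 * z1 - 26 / 75 * z2)) ^ 2 +
      l1 * (1 - l1 - l2) * (13 / 25 * z1) ^ 2 +
      l2 * (1 - l1 - l2) * (65 / 75 * z1 - 26 / 75 * z2) ^ 2 := by positivity
  refine le_of_sub_nonneg ((add_nonneg g j).trans_eq ?_)
  unfold lyapunov
  ring

theorem lyapunov_step {x y z0 z1 z2 : ℝ} (hx : 0 ≤ x) (hx' : x ≤ 3 / 2) (hy : 0 ≤ y)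
    (hy' : y ≤ 3 / 2) (h : d0 x y * z0 + d1 x y * z1 + d2 x y * z2 = 0) :
    lyapunov z0 z1 ≤ 81 / 100 * lyapunov z1 z2 := by
  have h0 := one_le_d0 hx hy
  have hp : 0 < d0 x y := by linarith
  have hb := d2_le_d0 hx hx' hy hy'
  have hsum := d0_add_d1_add_d2 hx hy
  -- Since the coefficients sum to one, the recursion depends only on `s = (d0 - 1) / d0` and `b =
  -- d2 / d0`.
  have hz : z0 = ((d0 x y - 1) / d0 x y + d2 x y / d0 x y) * z1 - d2 x y / d0 x y * z2 := by
    have : d1 x y = 1 - d0 x y - d2 x y := by linarith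
    rw [this] at h
    field_simp
    linarith
  rw [hz]
  refine lyapunov_le ?_ (div_nonneg (d2_nonneg hx hy) hp.le) ?_
  · rw [div_le_iff₀ hp]
    linarith [d0_le hx hx' hy hy']
  · rw [div_le_iff₀ hp]
    field_simp
    linarith

theorem abs_le_of_lyapunov_le {a b c : ℝ} (hc : 0 ≤ c) (h : lyapunov a b ≤ c ^ 2) :
    |a| ≤ 2 * c := by
  refine abs_le_of_sq_le_sq ?_ (by positivity)
  unfold lyapunov at h
  nlinarith [sq_nonneg (b - 4 / 3 * a)]

/-! ### DOC kernels as the inverse of the BDF3 convolution, and their geometric decay -/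

section DocKernels

variable {V : Type*} [AddCommGroup V] [Module ℝ V]

/-- The convolution `∑ⱼ d_j^{(n)} w^{n-j}` with the BDF3 kernels. -/
def kernelConv (t : ℕ → ℝ) (w : ℕ → V) (n : ℕ) : V :=
  kernel t n 0 • w n + kernel t n 1 • w (n - 1) + kernel t n 2 • w (n - 2)

theorem D3_eq_kernelConv (t : ℕ → ℝ) (v : ℕ → V) (n : ℕ) :
    D3 t v n = kernelConv t (diffQuot t v) n := rfl

/-- The DOC kernel preceding `docKernel t n m`, with value `0` for `m = 0`. -/
def docPrev (t : ℕ → ℝ) (n : ℕ) : ℕ → ℝ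
  | 0 => 0
  | m + 1 => docKernel t n m

theorem docPrev_zero (t : ℕ → ℝ) (n : ℕ) : docPrev t n 0 = 0 := rfl

theorem docPrev_succ (t : ℕ → ℝ) (n m : ℕ) : docPrev t n (m + 1) = docKernel t n m := rfl

theorem docKernel_zero (t : ℕ → ℝ) (n : ℕ) : docKernel t n 0 = 1 / kernel t n 0 := by
  rw [docKernel]

/-- The BDF3 kernels vanish from index 3 on, so only the last two terms of the defining sum survive.
-/
theorem docKernel_succ (t : ℕ → ℝ) {n m : ℕ} (hm : m ≤ n) :
    docKernel t n (m + 1) = -(1 / kernel t (n - (m + 1)) 0) *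
      (docKernel t n m * kernel t (n - m) 1 + docPrev t n m * kernel t (n - m + 1) 2) := by
  rw [docKernel]
  congr 1
  cases m with
  | zero => simp [docPrev]
  | succ m =>
    rw [Fin.sum_univ_castSucc, Fin.sum_univ_castSucc, Finset.sum_eq_zero, zero_add, add_comm]
    · simp only [Fin.val_last, Fin.val_castSucc, docPrev]
      rw [show m + 1 + 1 - (m + 1) = 1 by omega, show m + 1 + 1 - m = 2 by omega]
      rw [show n - (m + 1) + 1 = n - m by omega]
    · intro l _
      simp only [Fin.val_castSucc]
      rw [show m + 1 + 1 - l.val = m - 1 - l.val + 3 by omega, kernel, mul_zero]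

/-- Each new DOC kernel is chosen to cancel the leading residual of the preceding partial sum. What
remains besides `w n` sits on the next two entries only. -/
theorem sum_range_docKernel_smul_kernelConv {t : ℕ → ℝ} {n : ℕ}
    (hk : ∀ j, 3 ≤ j → j ≤ n → kernel t j 0 ≠ 0) (w : ℕ → V) (m : ℕ) (hm : m + 3 ≤ n) :
    ∑ l ∈ Finset.range (m + 1), docKernel t n l • kernelConv t w (n - l) =
      w n + (docKernel t n m * kernel t (n - m) 1 + docPrev t n m * kernel t (n - m + 1) 2) •
          w (n - m - 1) + (docKernel t n m * kernel t (n - m) 2) • w (n - m - 2) := by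
  induction m with
  | zero =>
    have h0 := hk n (by omega) le_rfl
    simp only [zero_add, Finset.sum_range_one, Nat.sub_zero, docKernel_zero, docPrev, zero_mul,
      add_zero, kernelConv, smul_add, smul_smul, one_div_mul_cancel h0, one_smul]
  | succ m ih =>
    have h0 := hk (n - (m + 1)) (by omega) (by omega)
    have hs : docKernel t n m * kernel t (n - m) 1 + docPrev t n m * kernel t (n - m + 1) 2 =
        -(docKernel t n (m + 1) * kernel t (n - (m + 1)) 0) := by
      rw [docKernel_succ t (by omega)]
      field_simp
    have e1 : n - (m + 1) = n - m - 1 := by omega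
    have e2 : n - m - 1 + 1 = n - m := by omega
    have e3 : n - m - 1 - 1 = n - m - 2 := by omega
    rw [Finset.sum_range_succ, ih (by omega), hs, kernelConv, e1, e2, e3, docPrev]
    module

theorem sum_Icc_eq_sum_range {M : Type*} [AddCommMonoid M] {n : ℕ} (g : ℕ → M) :
    ∑ j ∈ Finset.Icc 3 n, g j = ∑ m ∈ Finset.range (n - 2), g (n - m) := by
  refine Finset.sum_nbij' (fun j => n - j) (fun m => n - m) ?_ ?_ ?_ ?_ ?_ <;>
    simp only [Finset.mem_Icc, Finset.mem_range] <;> intro a ha <;> try omega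
  congr 1
  omega

/-- Discrete convolution with the DOC kernels inverts the BDF3 convolution up to starting values. -/
theorem sum_docKernel_smul_kernelConv {t : ℕ → ℝ} {n : ℕ} (hn : 3 ≤ n)
    (hk : ∀ j, 3 ≤ j → j ≤ n → kernel t j 0 ≠ 0) (w : ℕ → V) :
    ∑ j ∈ Finset.Icc 3 n, docKernel t n (n - j) • kernelConv t w j =
      w n + (docKernel t n (n - 3) * kernel t 3 1 + docPrev t n (n - 3) * kernel t 4 2) • w 2 +
        (docKernel t n (n - 3) * kernel t 3 2) • w 1 := by
  have h := sum_range_docKernel_smul_kernelConv hk w (n - 3) (by omega)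
  rw [show n - (n - 3) = 3 by omega, show n - 3 + 1 = n - 2 by omega] at h
  rw [← h, sum_Icc_eq_sum_range]
  refine Finset.sum_congr rfl fun m hm => ?_
  rw [Finset.mem_range] at hm
  rw [show n - (n - m) = m by omega]

/-- The solution of `∑ⱼ d_j^{(n)} w^{n-j} = gⁿ`, `n ≥ 3`, with zero starting values. -/
def kernelSolve (t : ℕ → ℝ) (g : ℕ → V) : ℕ → V
  | 0 => 0
  | 1 => 0
  | 2 => 0
  | n + 3 => (kernel t (n + 3) 0)⁻¹ • (g (n + 3) - kernel t (n + 3) 1 • kernelSolve t g (n + 2)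
      - kernel t (n + 3) 2 • kernelSolve t g (n + 1))

theorem kernelConv_kernelSolve {t : ℕ → ℝ} {n : ℕ} (hn : 3 ≤ n) (hk : kernel t n 0 ≠ 0)
    (g : ℕ → V) : kernelConv t (kernelSolve t g) n = g n := by
  obtain ⟨n, rfl⟩ : ∃ m, n = m + 3 := ⟨n - 3, by omega⟩
  simp only [kernelConv, Nat.reduceSubDiff, kernelSolve, smul_inv_smul₀ hk]
  abel_nf

theorem sum_docKernel_smul {t : ℕ → ℝ} {n : ℕ} (hn : 3 ≤ n)
    (hk : ∀ j, 3 ≤ j → j ≤ n → kernel t j 0 ≠ 0) (g : ℕ → V) :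
    ∑ j ∈ Finset.Icc 3 n, docKernel t n (n - j) • g j = kernelSolve t g n := by
  have h := sum_docKernel_smul_kernelConv hn hk (kernelSolve t g)
  simp only [kernelSolve, smul_zero, add_zero] at h
  rw [← h]
  refine Finset.sum_congr rfl fun j hj => ?_
  rw [Finset.mem_Icc] at hj
  rw [kernelConv_kernelSolve hj.1 (hk j hj.1 hj.2)]

/-- This identification gives column-wise access to the DOC kernels, whose definition runs along
rows: with `i` fixed they satisfy the BDF3 recursion in `n`. -/
theorem docKernel_eq_kernelSolve {t : ℕ → ℝ} {n i : ℕ} (hi : 3 ≤ i) (hin : i ≤ n)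
    (hk : ∀ j, 3 ≤ j → j ≤ n → kernel t j 0 ≠ 0) :
    docKernel t n (n - i) = kernelSolve t (Pi.single i (1 : ℝ)) n := by
  rw [← sum_docKernel_smul (hi.trans hin) hk, Finset.sum_eq_single i]
  · simp
  · intro j _ hj
    simp [hj]
  · intro h
    exact absurd (Finset.mem_Icc.2 ⟨hi, hin⟩) h

theorem kernelSolve_eq_zero {t : ℕ → ℝ} {g : ℕ → V} {i : ℕ} (hg : ∀ j < i, g j = 0) (n : ℕ)
    (hn : n < i) : kernelSolve t g n = 0 := by
  induction n using Nat.strong_induction_on with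
  | _ n ih =>
    match n with
    | 0 => rfl
    | 1 => rfl
    | 2 => rfl
    | n + 3 =>
      rw [kernelSolve, hg _ hn, ih (n + 2) (by omega) (by omega),
        ih (n + 1) (by omega) (by omega)]
      simp

/-- All step ratios lie in `[0, 3/2]`. -/
def RatiosBounded (t : ℕ → ℝ) (N : ℕ) : Prop :=
  ∀ k, 2 ≤ k → k ≤ N → 0 ≤ ratio t k ∧ ratio t k ≤ 3 / 2

theorem RatiosAdmissible.bounded {t : ℕ → ℝ} {N : ℕ} (h : RatiosAdmissible t N) :
    RatiosBounded t N := fun k hk hkN =>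
  ⟨(h k hk hkN).1.le, (h k hk hkN).2.le.trans stepRatioLimit_lt.le⟩

theorem RatiosBounded.one_le_kernel {t : ℕ → ℝ} {N : ℕ} (h : RatiosBounded t N) {n : ℕ}
    (hn : 3 ≤ n) (hnN : n ≤ N) : 1 ≤ kernel t n 0 :=
  one_le_d0 (h n (by omega) hnN).1 (h (n - 1) (by omega) (by omega)).1

theorem RatiosBounded.kernel_ne_zero {t : ℕ → ℝ} {N : ℕ} (h : RatiosBounded t N) {n : ℕ}
    (hnN : n ≤ N) (j : ℕ) (hj : 3 ≤ j) (hjn : j ≤ n) : kernel t j 0 ≠ 0 :=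
  (zero_lt_one.trans_le (h.one_le_kernel hj (hjn.trans hnN))).ne'

theorem lyapunov_kernelSolve_le {t : ℕ → ℝ} {N : ℕ} (h : RatiosBounded t N) {i : ℕ} (hi : 3 ≤ i)
    (m : ℕ) (hm : i + m ≤ N) :
    lyapunov (kernelSolve t (Pi.single i (1 : ℝ)) (i + m))
      (kernelSolve t (Pi.single i (1 : ℝ)) (i + m - 1)) ≤ (81 / 100) ^ m := by
  have hz : ∀ j < i, (Pi.single i (1 : ℝ) : ℕ → ℝ) j = 0 := fun j hj => by
    simp [hj.ne]
  have hconv : ∀ j, 3 ≤ j → j ≤ N → _ := fun j hj hjN =>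
    kernelConv_kernelSolve hj (h.kernel_ne_zero hjN j hj le_rfl) (Pi.single i (1 : ℝ))
  induction m with
  | zero =>
    have h0 := kernelSolve_eq_zero (t := t) hz (i - 1) (by omega)
    have h1 := kernelSolve_eq_zero (t := t) hz (i - 2) (by omega)
    -- At the impulse both earlier values vanish, so the response is `1 / d0`, which lies in `(0,
    -- 1]`.
    have h2 := hconv i hi (by omega)
    have h3 := h.one_le_kernel hi (by omega)
    simp only [kernelConv, h0, h1, smul_eq_mul, mul_zero, add_zero, Pi.single_eq_same] at h2
    rw [add_zero, h0]
    unfold lyapunov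
    set z := kernelSolve t (Pi.single i (1 : ℝ)) i
    have h4 : 0 < z := by
      by_contra! hc
      nlinarith
    have h5 : z ≤ 1 := by nlinarith
    nlinarith
  | succ m ih =>
    have h2 := hconv (i + (m + 1)) (by omega) hm
    rw [kernelConv, Pi.single_eq_of_ne (by omega)] at h2
    have hr := h (i + (m + 1)) (by omega) hm
    have hr' := h (i + (m + 1) - 1) (by omega) (by omega)
    refine (lyapunov_step hr.1 hr.2 hr'.1 hr'.2 h2).trans ?_
    rw [show i + (m + 1) - 2 = i + m - 1 by omega, show i + (m + 1) - 1 = i + m by omega, pow_succ]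
    linarith [ih (by omega)]

theorem abs_docKernel_le {t : ℕ → ℝ} {N : ℕ} (h : RatiosBounded t N) {n i : ℕ} (hi : 3 ≤ i)
    (hin : i ≤ n) (hn : n ≤ N) : |docKernel t n (n - i)| ≤ 2 * (9 / 10) ^ (n - i) := by
  obtain ⟨m, rfl⟩ := Nat.exists_eq_add_of_le hin
  rw [docKernel_eq_kernelSolve hi hin (h.kernel_ne_zero hn), Nat.add_sub_cancel_left]
  refine abs_le_of_lyapunov_le (by positivity) ((lyapunov_kernelSolve_le h hi m hn).trans_eq ?_)
  rw [← pow_mul, mul_comm, pow_mul]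
  norm_num

theorem sum_two_mul_pow_le {s : Finset ℕ} {f : ℕ → ℕ} (hf : Set.InjOn f s) :
    ∑ j ∈ s, 2 * (9 / 10 : ℝ) ^ f j ≤ 20 := by
  have hs : HasSum (fun n : ℕ => (9 / 10 : ℝ) ^ n) 10 := by
    have := hasSum_geometric_of_lt_one (r := (9 / 10 : ℝ)) (by norm_num) (by norm_num)
    norm_num at this
    exact this
  rw [← Finset.mul_sum, ← Finset.sum_image (f := fun n : ℕ => (9 / 10 : ℝ) ^ n) hf]
  have := sum_le_hasSum (s.image f) (fun n _ => by positivity) hs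
  linarith

theorem RatiosBounded.isDocBound {t : ℕ → ℝ} {N : ℕ} (h : RatiosBounded t N) :
    IsDocBound t N 20 := by
  intro n hn hnN
  constructor
  · refine (Finset.sum_le_sum fun j hj => ?_).trans
      (sum_two_mul_pow_le (s := Finset.Icc 3 n) (f := fun j => n - j) ?_)
    · rw [Finset.mem_Icc] at hj
      exact abs_docKernel_le h hj.1 hj.2 hnN
    · intro a ha b hb hab
      simp only [Finset.coe_Icc, mem_Icc] at ha hb hab
      omega
  · intro i hi hin
    refine (Finset.sum_le_sum fun j hj => ?_).trans
      (sum_two_mul_pow_le (s := Finset.Icc i n) (f := fun j => j - i) ?_)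
    · rw [Finset.mem_Icc] at hj
      exact abs_docKernel_le h hi hj.1 (hj.2.trans hnN)
    · intro a ha b hb hab
      simp only [Finset.coe_Icc, mem_Icc] at ha hb hab
      omega

theorem IsDocBound.mono {t : ℕ → ℝ} {N : ℕ} {K K' : ℝ} (h : IsDocBound t N K) (hK : K ≤ K') :
    IsDocBound t N K' := fun n hn hnN =>
  ⟨(h n hn hnN).1.trans hK, fun i hi hin => ((h n hn hnN).2 i hi hin).trans hK⟩

end DocKernels

/-! ### Dissipation inequality, positive semidefiniteness of the DOC kernels, and discrete Grönwall
-/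

section Dissipation

variable {H : Type*} [NormedAddCommGroup H] [InnerProductSpace ℝ H]

theorem norm_add_smul_sq (u v : H) (b : ℝ) :
    ‖u + b • v‖ ^ 2 = ‖u‖ ^ 2 + 2 * b * inner ℝ v u + b ^ 2 * ‖v‖ ^ 2 := by
  rw [norm_add_sq_real, norm_smul, inner_smul_right, real_inner_comm, mul_pow, Real.norm_eq_abs,
    sq_abs]
  ring

theorem norm_add_smul_add_smul_sq (u v w : H) (b c : ℝ) :
    ‖u + b • v + c • w‖ ^ 2 = ‖u‖ ^ 2 + b ^ 2 * ‖v‖ ^ 2 + c ^ 2 * ‖w‖ ^ 2 +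
      2 * b * inner ℝ v u + 2 * c * inner ℝ w u + 2 * (b * c) * inner ℝ v w := by
  rw [norm_add_smul_sq, norm_add_smul_sq, inner_add_right, inner_smul_right, real_inner_comm v w]
  ring

/-- This is the one-step dissipation inequality in units where `τ_{k-2} = 1`, so that `τ_{k-1} = y`
and `τ_k = xy`. The difference of the two sides is a sum of three squares, found by eliminating `z2`
and then `z1`; the last coefficient is nonnegative by `discriminant_nonneg`. -/
theorem storage_decrease {x y : ℝ} (hx : 0 ≤ x) (hx' : x ≤ 3 / 2) (hy : 0 ≤ y)
    (hy' : y ≤ 3 / 2) (z0 z1 z2 : H) :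
    x * y * (9 / 10 * ‖z0‖ ^ 2 - 3 / 5 * inner ℝ z0 z1) + 2 / 5 * y * ‖z1‖ ^ 2 -
        (y * (9 / 10 * ‖z1‖ ^ 2 - 3 / 5 * inner ℝ z1 z2) + 2 / 5 * ‖z2‖ ^ 2) ≤
      x * y * inner ℝ z0 (d0 x y • z0 + d1 x y • z1 + d2 x y • z2) := by
  have hdisc := discriminant_nonneg hx hx' hy hy'
  obtain ⟨a, ha⟩ : ∃ a, a = d0 x y - 9 / 10 - 5 / 8 * (x * y * d2 x y ^ 2) := ⟨_, rfl⟩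
  obtain ⟨b, hb⟩ : ∃ b, b = d1 x y + 3 / 5 + 3 / 4 * (y * d2 x y) := ⟨_, rfl⟩
  obtain ⟨g, hg⟩ : ∃ g, g = 1 / 2 - 9 / 40 * y := ⟨_, rfl⟩
  rw [← ha, ← hb, ← hg] at hdisc
  have hgp : 0 < g := by linarith
  have hq : 0 ≤ a - x * b ^ 2 / (4 * g) := by
    rw [sub_nonneg, div_le_iff₀ (by positivity)]
    linarith
  have key : 0 ≤ 2 / 5 * ‖z2 + (5 / 4 * (x * y * d2 x y)) • z0 + (-(3 / 4) * y) • z1‖ ^ 2 +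
      y * g * ‖z1 + (x * b / (2 * g)) • z0‖ ^ 2 +
      x * y * (a - x * b ^ 2 / (4 * g)) * ‖z0‖ ^ 2 := by positivity
  rw [norm_add_smul_add_smul_sq, norm_add_smul_sq] at key
  have e1 : y * g * (‖z1‖ ^ 2 + 2 * (x * b / (2 * g)) * inner ℝ z0 z1 +
      (x * b / (2 * g)) ^ 2 * ‖z0‖ ^ 2) + x * y * (a - x * b ^ 2 / (4 * g)) * ‖z0‖ ^ 2 =
      y * g * ‖z1‖ ^ 2 + x * y * b * inner ℝ z0 z1 + x * y * a * ‖z0‖ ^ 2 := by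
    field_simp
    ring
  rw [add_assoc, e1, ha, hb, hg] at key
  simp only [inner_add_right, inner_smul_right, real_inner_self_eq_norm_sq]
  linarith

/-- The storage function in the dissipation inequality of the BDF3 convolution. -/
def storage (t : ℕ → ℝ) (z : ℕ → H) (k : ℕ) : ℝ :=
  step t k * (9 / 10 * ‖z k‖ ^ 2 - 3 / 5 * inner ℝ (z k) (z (k - 1))) +
    2 / 5 * step t (k - 1) * ‖z (k - 1)‖ ^ 2

/-- The ratio bound gives `2/5 τ_{k-1} ≥ 4/15 τ_k`, and the form `9/10 a² - 3/5 ab + 4/15 b²` is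
positive definite. -/
theorem storage_nonneg {t : ℕ → ℝ} (z : ℕ → H) {k : ℕ} (h0 : 0 < step t k)
    (h1 : 0 < step t (k - 1)) (hr : ratio t k ≤ 3 / 2) : 0 ≤ storage t z k := by
  rw [ratio, div_le_iff₀ h1] at hr
  have h := real_inner_le_norm (z k) (z (k - 1))
  have e1 : 0 ≤ step t k * (9 / 10 * ‖z k‖ ^ 2 - 3 / 5 * (‖z k‖ * ‖z (k - 1)‖) +
      4 / 15 * ‖z (k - 1)‖ ^ 2) := by
    refine mul_nonneg h0.le ?_
    nlinarith [sq_nonneg (‖z k‖ - ‖z (k - 1)‖ / 3), sq_nonneg ‖z (k - 1)‖]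
  have e2 := mul_le_mul_of_nonneg_left h h0.le
  have e3 := mul_le_mul_of_nonneg_right hr (sq_nonneg ‖z (k - 1)‖)
  unfold storage
  linarith

theorem storage_sub_le {t : ℕ → ℝ} (z : ℕ → H) {k : ℕ} (h1 : 0 < step t (k - 1))
    (h2 : 0 < step t (k - 2)) (hx : 0 ≤ ratio t k) (hx' : ratio t k ≤ 3 / 2)
    (hy : 0 ≤ ratio t (k - 1)) (hy' : ratio t (k - 1) ≤ 3 / 2) :
    storage t z k - storage t z (k - 1) ≤ step t k * inner ℝ (z k) (kernelConv t z k) := by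
  have h := storage_decrease hx hx' hy hy' (z k) (z (k - 1)) (z (k - 2))
  have e1 : step t (k - 1) = ratio t (k - 1) * step t (k - 2) := by
    rw [ratio, show k - 1 - 1 = k - 2 by omega, div_mul_cancel₀ _ h2.ne']
  have e0 : step t k = ratio t k * ratio t (k - 1) * step t (k - 2) := by
    rw [mul_assoc, ← e1, ratio, div_mul_cancel₀ _ h1.ne']
  have h' := mul_le_mul_of_nonneg_left h h2.le
  unfold storage kernelConv
  rw [show k - 1 - 1 = k - 2 by omega, e0, e1]
  simp only [kernel]
  linarith

theorem sum_step_mul_inner_kernelConv_nonneg {t : ℕ → ℝ} {N : ℕ}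
    (hτ : ∀ k, 1 ≤ k → k ≤ N → 0 < step t k) (hr : RatiosBounded t N) (z : ℕ → H) (hz1 : z 1 = 0)
    (hz2 : z 2 = 0) (n : ℕ) (hn : 2 ≤ n) (hnN : n ≤ N) :
    0 ≤ ∑ k ∈ Finset.Icc 3 n, step t k * inner ℝ (z k) (kernelConv t z k) := by
  have key : storage t z n ≤
      ∑ k ∈ Finset.Icc 3 n, step t k * inner ℝ (z k) (kernelConv t z k) := by
    induction n, hn using Nat.le_induction with
    | base => simp [storage, hz1, hz2]
    | succ n hn ih =>
      rw [Finset.sum_Icc_succ_top (by omega)]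
      have h1 := hr (n + 1) (by omega) hnN
      have h2 := hr n (by omega) (by omega)
      have := storage_sub_le z (k := n + 1) (hτ n (by omega) (by omega))
        (hτ (n - 1) (by omega) (by omega)) h1.1 h1.2 h2.1 h2.2
      rw [Nat.add_sub_cancel] at this
      linarith [ih (by omega)]
  exact (storage_nonneg z (hτ n (by omega) hnN) (hτ (n - 1) (by omega) (by omega))
    (hr n hn hnN).2).trans key

/-- The DOC kernels are positive semidefinite. -/
theorem sum_step_mul_inner_docKernel_nonneg {t : ℕ → ℝ} {N : ℕ}
    (hτ : ∀ k, 1 ≤ k → k ≤ N → 0 < step t k) (hr : RatiosBounded t N) (g : ℕ → H) (n : ℕ)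
    (hn : 2 ≤ n) (hnN : n ≤ N) :
    0 ≤ ∑ k ∈ Finset.Icc 3 n,
      step t k * inner ℝ (∑ j ∈ Finset.Icc 3 k, docKernel t k (k - j) • g j) (g k) := by
  -- Put `z = kernelSolve t g`: then `z` is the DOC convolution of `g`, and `g` is the BDF3
  -- convolution of `z`.
  refine (sum_step_mul_inner_kernelConv_nonneg hτ hr (kernelSolve t g) rfl rfl n hn hnN).trans_eq
    (Finset.sum_congr rfl fun k hk => ?_)
  rw [Finset.mem_Icc] at hk
  have hk0 := hr.kernel_ne_zero (hk.2.trans hnN)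
  rw [sum_docKernel_smul hk.1 hk0, kernelConv_kernelSolve hk.1 (hk0 k hk.1 le_rfl)]

theorem half_norm_sq_sub_le {t : ℕ → ℝ} (e : ℕ → H) {k : ℕ} (hk : 0 < step t k) :
    1 / 2 * (‖e k‖ ^ 2 - ‖e (k - 1)‖ ^ 2) ≤ step t k * inner ℝ (diffQuot t e k) (e k) := by
  rw [diffQuot, real_inner_smul_left, mul_inv_cancel_left₀ hk.ne', inner_sub_left,
    real_inner_self_eq_norm_sq]
  have := real_inner_le_norm (e (k - 1)) (e k)
  nlinarith [sq_nonneg (‖e k‖ - ‖e (k - 1)‖)]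

theorem sum_step {t : ℕ → ℝ} (n : ℕ) (hn : 2 ≤ n) :
    ∑ k ∈ Finset.Icc 3 n, step t k = t n - t 2 := by
  induction n, hn using Nat.le_induction with
  | base => simp
  | succ n hn ih =>
    rw [Finset.sum_Icc_succ_top (by omega), ih, step, Nat.add_sub_cancel]
    ring

/-- A discrete Grönwall inequality in terms of the time levels. -/
theorem le_mul_exp_of_le_add_sum {t x : ℕ → ℝ} {a c : ℝ} {n : ℕ} (ha : 0 ≤ a) (hc : 0 ≤ c)
    (hτ : ∀ k, 3 ≤ k → k ≤ n → 0 < step t k)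
    (h : ∀ l, 3 ≤ l → l ≤ n → x l ≤ a + c * ∑ k ∈ Finset.Icc 3 (l - 1), step t k * x k)
    (hn : 3 ≤ n) : x n ≤ a * Real.exp (c * (t (n - 1) - t 2)) := by
  have key : ∀ l, 2 ≤ l → l < n →
      a + c * ∑ k ∈ Finset.Icc 3 l, step t k * x k ≤ a * Real.exp (c * (t l - t 2)) := by
    intro l hl
    induction l, hl using Nat.le_induction with
    | base => intro _; simp
    | succ l hl ih =>
      intro hln
      have h1 := ih (by omega)
      have h2 := h (l + 1) (by omega) hln.le
      rw [Nat.add_sub_cancel] at h2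
      have hs := hτ (l + 1) (by omega) hln.le
      have h3 := mul_le_mul_of_nonneg_left (h2.trans h1) (mul_nonneg hc hs.le)
      have h4 : 1 + c * step t (l + 1) ≤ Real.exp (c * step t (l + 1)) := by
        linarith [Real.add_one_le_exp (c * step t (l + 1))]
      have h5 : Real.exp (c * (t (l + 1) - t 2)) =
          Real.exp (c * (t l - t 2)) * Real.exp (c * step t (l + 1)) := by
        rw [← Real.exp_add, step, Nat.add_sub_cancel]
        ring_nf
      have h6 := mul_le_mul_of_nonneg_left h4
        (mul_nonneg ha (Real.exp_nonneg (c * (t l - t 2))))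
      rw [Finset.sum_Icc_succ_top (by omega), h5]
      linarith
  exact (h n hn le_rfl).trans (key (n - 1) (by omega) (by omega))

end Dissipation

/-! ### Energy estimate for the error equation -/

section Stability

variable {H H' : Type*} [NormedAddCommGroup H] [InnerProductSpace ℝ H]
  [NormedAddCommGroup H'] [InnerProductSpace ℝ H']

/-- The weight of `∂_τ v¹` in the DOC-transformed BDF3 formula. -/
def startWeight₁ (t : ℕ → ℝ) (k : ℕ) : ℝ := docKernel t k (k - 3) * kernel t 3 2

/-- The weight of `∂_τ v²` in the DOC-transformed BDF3 formula. -/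
def startWeight₂ (t : ℕ → ℝ) (k : ℕ) : ℝ :=
  docKernel t k (k - 3) * kernel t 3 1 + docPrev t k (k - 3) * kernel t 4 2

theorem d2_le_one {x y : ℝ} (hx : 0 ≤ x) (hx' : x ≤ 3 / 2) (hy : 0 ≤ y) (hy' : y ≤ 3 / 2) :
    d2 x y ≤ 1 := by
  linarith [d2_le_d0 hx hx' hy hy', d0_le hx hx' hy hy']

theorem abs_d1_le_two {x y : ℝ} (hx : 0 ≤ x) (hx' : x ≤ 3 / 2) (hy : 0 ≤ y) (hy' : y ≤ 3 / 2) :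
    |d1 x y| ≤ 2 := by
  rw [abs_le]
  constructor <;> linarith [d2_le_d0 hx hx' hy hy', d0_le hx hx' hy hy', one_le_d0 hx hy,
    d2_nonneg hx hy, d0_add_d1_add_d2 hx hy]

section Kernels

variable {t : ℕ → ℝ} {N : ℕ} {K : ℝ}

theorem RatiosBounded.abs_kernel_one_le (h : RatiosBounded t N) {n : ℕ} (hn : 3 ≤ n)
    (hnN : n ≤ N) : |kernel t n 1| ≤ 2 := by
  have h1 := h n (by omega) hnN
  have h2 := h (n - 1) (by omega) (by omega)
  exact abs_d1_le_two h1.1 h1.2 h2.1 h2.2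

theorem RatiosBounded.abs_kernel_two_le (h : RatiosBounded t N) {n : ℕ} (hn : 3 ≤ n)
    (hnN : n ≤ N) : |kernel t n 2| ≤ 1 := by
  have h1 := h n (by omega) hnN
  have h2 := h (n - 1) (by omega) (by omega)
  rw [kernel, abs_of_nonneg (d2_nonneg h1.1 h2.1)]
  exact d2_le_one h1.1 h1.2 h2.1 h2.2

theorem sum_abs_startWeight₁_le (hr : RatiosBounded t N) (hK : IsDocBound t N K) {m : ℕ}
    (hm : 3 ≤ m) (hmN : m ≤ N) : ∑ k ∈ Finset.Icc 3 m, |startWeight₁ t k| ≤ K := by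
  refine le_trans (Finset.sum_le_sum fun k _ => ?_) ((hK m hm hmN).2 3 le_rfl hm)
  rw [startWeight₁, abs_mul]
  exact mul_le_of_le_one_right (abs_nonneg _) (hr.abs_kernel_two_le le_rfl (hm.trans hmN))

theorem sum_abs_docPrev_le (hr : RatiosBounded t N) (hK : IsDocBound t N K) {m : ℕ}
    (hm : 3 ≤ m) (hmN : m ≤ N) :
    ∑ k ∈ Finset.Icc 3 m, |docPrev t k (k - 3) * kernel t 4 2| ≤ K := by
  -- The term `k = 3` is zero by the convention for `docPrev`; the others belong to the column of
  -- index 4.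
  rw [← Finset.insert_Icc_add_one_left_eq_Icc hm, Finset.sum_insert (by simp)]
  simp only [Nat.sub_self, docPrev_zero, zero_mul, abs_zero, zero_add, Nat.reduceAdd]
  rcases hm.eq_or_lt with rfl | hm'
  · simp only [show Finset.Icc 4 3 = (∅ : Finset ℕ) from rfl, Finset.sum_empty]
    exact le_trans (Finset.sum_nonneg fun _ _ => abs_nonneg _) (hK 3 le_rfl hmN).1
  · refine le_trans (Finset.sum_le_sum fun k hk => ?_) ((hK m hm hmN).2 4 (by norm_num) hm')
    rw [Finset.mem_Icc] at hk
    obtain ⟨l, rfl⟩ := Nat.exists_eq_add_of_le hk.1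
    rw [show 4 + l - 3 = l + 1 by omega, show 4 + l - 4 = l by omega, docPrev_succ, abs_mul]
    exact mul_le_of_le_one_right (abs_nonneg _)
      (hr.abs_kernel_two_le (by norm_num) (le_trans hm' hmN))

theorem sum_abs_startWeight₂_le (hr : RatiosBounded t N) (hK : IsDocBound t N K) {m : ℕ}
    (hm : 3 ≤ m) (hmN : m ≤ N) : ∑ k ∈ Finset.Icc 3 m, |startWeight₂ t k| ≤ 3 * K := by
  have h1 : ∑ k ∈ Finset.Icc 3 m, |docKernel t k (k - 3) * kernel t 3 1| ≤ K * 2 := by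
    refine le_trans (Finset.sum_le_sum fun k _ => ?_) ((Finset.sum_mul _ _ _).symm.le.trans
      (mul_le_mul_of_nonneg_right ((hK m hm hmN).2 3 le_rfl hm) zero_le_two))
    rw [abs_mul]
    exact mul_le_mul_of_nonneg_left (hr.abs_kernel_one_le le_rfl (hm.trans hmN)) (abs_nonneg _)
  have h2 := sum_abs_docPrev_le hr hK hm hmN
  have h3 := Finset.sum_le_sum fun k (_ : k ∈ Finset.Icc 3 m) =>
    abs_add_le (docKernel t k (k - 3) * kernel t 3 1) (docPrev t k (k - 3) * kernel t 4 2)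
  rw [Finset.sum_add_distrib] at h3
  unfold startWeight₂
  linarith

end Kernels

/-- The error equation `D₃eᵏ = Wᵏ + Fᵏ`, where the pairing of `W` with `e` is minus the Gram matrix
of `G` and `F` is a reaction term plus a perturbation of size `η`. -/
structure IsErrorEquation (t : ℕ → ℝ) (N : ℕ) (κ η : ℝ) (e W F : ℕ → H) (G : ℕ → H') : Prop where
  eq : ∀ k, 3 ≤ k → k ≤ N → D3 t e k = W k + F k
  gram : ∀ j k, 3 ≤ j → j ≤ N → 3 ≤ k → k ≤ N → inner ℝ (W j) (e k) = -inner ℝ (G j) (G k)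
  bound : ∀ k, 3 ≤ k → k ≤ N → ‖F k‖ ≤ κ * ‖e k‖ + η

section Energy

variable {t : ℕ → ℝ} {N : ℕ} {K κ η τ : ℝ} {e W F : ℕ → H} {G : ℕ → H'}

/-- The Gram identity turns the sum into minus the DOC quadratic form evaluated at `G`. -/
theorem sum_step_mul_inner_nonpos (hτ : ∀ k, 1 ≤ k → k ≤ N → 0 < step t k)
    (hr : RatiosBounded t N) (he : IsErrorEquation t N κ η e W F G) {m : ℕ} (hm : 3 ≤ m)
    (hmN : m ≤ N) :
    ∑ k ∈ Finset.Icc 3 m,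
      step t k * inner ℝ (∑ j ∈ Finset.Icc 3 k, docKernel t k (k - j) • W j) (e k) ≤ 0 := by
  have h := sum_step_mul_inner_docKernel_nonneg hτ hr G m (by omega) hmN
  rw [← neg_nonneg, ← Finset.sum_neg_distrib]
  refine h.trans_eq (Finset.sum_congr rfl fun k hk => ?_)
  rw [Finset.mem_Icc] at hk
  rw [← mul_neg, sum_inner, sum_inner, ← Finset.sum_neg_distrib]
  congr 1
  refine Finset.sum_congr rfl fun j hj => ?_
  rw [Finset.mem_Icc] at hj
  rw [real_inner_smul_left, real_inner_smul_left,
    he.gram j k hj.1 (hj.2.trans (hk.2.trans hmN)) hk.1 (hk.2.trans hmN)]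
  ring

theorem diffQuot_eq_of_isErrorEquation (hr : RatiosBounded t N)
    (he : IsErrorEquation t N κ η e W F G) {k : ℕ} (hk : 3 ≤ k) (hkN : k ≤ N) :
    diffQuot t e k = ∑ j ∈ Finset.Icc 3 k, docKernel t k (k - j) • W j +
      (∑ j ∈ Finset.Icc 3 k, docKernel t k (k - j) • F j -
        startWeight₂ t k • diffQuot t e 2 - startWeight₁ t k • diffQuot t e 1) := by
  have h := sum_docKernel_smul_kernelConv hk (hr.kernel_ne_zero hkN) (diffQuot t e)
  rw [← startWeight₁, ← startWeight₂] at h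
  rw [← add_sub_assoc, ← add_sub_assoc, ← Finset.sum_add_distrib, eq_sub_iff_add_eq,
    eq_sub_iff_add_eq, add_right_comm, ← h]
  refine Finset.sum_congr rfl fun j hj => ?_
  rw [Finset.mem_Icc] at hj
  rw [← D3_eq_kernelConv, he.eq j hj.1 (hj.2.trans hkN), smul_add]

theorem norm_sum_docKernel_smul_le (hK : IsDocBound t N K) (hκ : 0 ≤ κ) (hη : 0 ≤ η)
    (he : IsErrorEquation t N κ η e W F G) {m : ℕ}
    (hmax : ∀ j, 2 ≤ j → j ≤ m → ‖e j‖ ≤ ‖e m‖) {k : ℕ} (hk : 3 ≤ k) (hkm : k ≤ m)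
    (hkN : k ≤ N) :
    ‖∑ j ∈ Finset.Icc 3 k, docKernel t k (k - j) • F j‖ ≤ K * (κ * ‖e m‖ + η) := by
  refine (norm_sum_le _ _).trans ((Finset.sum_le_sum fun j hj => ?_).trans
    ((Finset.sum_mul _ _ _).symm.le.trans
      (mul_le_mul_of_nonneg_right (hK k hk hkN).1 (by positivity))))
  rw [Finset.mem_Icc] at hj
  rw [norm_smul, Real.norm_eq_abs]
  refine mul_le_mul_of_nonneg_left ((he.bound j hj.1 (hj.2.trans hkN)).trans ?_) (abs_nonneg _)
  have := mul_le_mul_of_nonneg_left (hmax j (by omega) (hj.2.trans hkm)) hκ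
  linarith

theorem half_norm_sq_sub_le_of_isErrorEquation (hτ : ∀ k, 1 ≤ k → k ≤ N → 0 < step t k)
    (hτ' : ∀ k, 1 ≤ k → k ≤ N → step t k ≤ τ) (hr : RatiosBounded t N) (hK : IsDocBound t N K)
    (hκ : 0 ≤ κ) (hη : 0 ≤ η) (he : IsErrorEquation t N κ η e W F G) {m : ℕ}
    (hmax : ∀ j, 2 ≤ j → j ≤ m → ‖e j‖ ≤ ‖e m‖) {k : ℕ} (hk : 3 ≤ k) (hkm : k ≤ m)
    (hkN : k ≤ N) :
    1 / 2 * (‖e k‖ ^ 2 - ‖e (k - 1)‖ ^ 2) ≤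
      step t k * inner ℝ (∑ j ∈ Finset.Icc 3 k, docKernel t k (k - j) • W j) (e k) +
        ‖e m‖ * (K * κ * (step t k * ‖e k‖) + K * η * step t k +
          τ * ‖diffQuot t e 2‖ * |startWeight₂ t k| +
          τ * ‖diffQuot t e 1‖ * |startWeight₁ t k|) := by
  have hs := hτ k (by omega) hkN
  have hs' := hτ' k (by omega) hkN
  have hem := hmax k (by omega) hkm
  have hK0 : 0 ≤ K := le_trans (Finset.sum_nonneg fun _ _ => abs_nonneg _) (hK k hk hkN).1
  refine (half_norm_sq_sub_le e hs).trans ?_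
  rw [diffQuot_eq_of_isErrorEquation hr he hk hkN, inner_add_left, mul_add]
  refine add_le_add le_rfl ?_
  have hF := norm_sum_docKernel_smul_le hK hκ hη he hmax hk hkm hkN
  set S := ∑ j ∈ Finset.Icc 3 k, docKernel t k (k - j) • F j
  have h1 : ‖S - startWeight₂ t k • diffQuot t e 2 - startWeight₁ t k • diffQuot t e 1‖ ≤
      K * (κ * ‖e m‖ + η) + |startWeight₂ t k| * ‖diffQuot t e 2‖ +
        |startWeight₁ t k| * ‖diffQuot t e 1‖ := by
    have a1 := norm_sub_le (S - startWeight₂ t k • diffQuot t e 2)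
      (startWeight₁ t k • diffQuot t e 1)
    have a2 := norm_sub_le S (startWeight₂ t k • diffQuot t e 2)
    rw [norm_smul, Real.norm_eq_abs] at a1 a2
    linarith
  have h2 := (real_inner_le_norm (S - startWeight₂ t k • diffQuot t e 2 -
    startWeight₁ t k • diffQuot t e 1) (e k)).trans
      (mul_le_mul_of_nonneg_right h1 (norm_nonneg _))
  have h3 := mul_le_mul_of_nonneg_left h2 hs.le
  have b1 := mul_le_mul_of_nonneg_left hem (mul_nonneg (mul_nonneg hK0 hη) hs.le)
  have b2 : step t k * ‖e k‖ ≤ τ * ‖e m‖ :=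
    mul_le_mul hs' hem (norm_nonneg _) (hs.le.trans hs')
  have b3 := mul_le_mul_of_nonneg_left b2
    (mul_nonneg (abs_nonneg (startWeight₂ t k)) (norm_nonneg (diffQuot t e 2)))
  have b4 := mul_le_mul_of_nonneg_left b2
    (mul_nonneg (abs_nonneg (startWeight₁ t k)) (norm_nonneg (diffQuot t e 1)))
  linarith

theorem sum_sub_pred (f : ℕ → ℝ) (n : ℕ) (hn : 2 ≤ n) :
    ∑ k ∈ Finset.Icc 3 n, (f k - f (k - 1)) = f n - f 2 := by
  induction n, hn using Nat.le_induction with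
  | base => simp
  | succ n hn ih =>
    rw [Finset.sum_Icc_succ_top (by omega), ih, Nat.add_sub_cancel]
    ring

/-- The starting and perturbation terms of the stability estimate. -/
def dataTerm (t : ℕ → ℝ) (K η τ : ℝ) (e : ℕ → H) (n : ℕ) : ℝ :=
  ‖e 2‖ + 2 * K * τ * ‖diffQuot t e 1‖ + 6 * K * τ * ‖diffQuot t e 2‖ +
    2 * K * η * (t n - t 2)

/-- When `‖e m‖` dominates the earlier norms, the summed energy inequality has a factor `‖e m‖` on
its right and can be divided by it. The step restriction lets the last reaction term, at most `‖e m‖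
/ 4`, be absorbed on the left. -/
theorem norm_le_of_isMax (hτ : ∀ k, 1 ≤ k → k ≤ N → 0 < step t k)
    (hτ' : ∀ k, 1 ≤ k → k ≤ N → step t k ≤ τ) (hr : RatiosBounded t N) (hK : IsDocBound t N K)
    (hκ : 0 ≤ κ) (hη : 0 ≤ η) (hκτ : 4 * K * κ * τ ≤ 1) (he : IsErrorEquation t N κ η e W F G)
    {m : ℕ} (hmax : ∀ j, 2 ≤ j → j ≤ m → ‖e j‖ ≤ ‖e m‖) (hm : 3 ≤ m) (hmN : m ≤ N) :
    ‖e m‖ ≤ 2 * dataTerm t K η τ e m +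
      4 * K * κ * ∑ k ∈ Finset.Icc 3 (m - 1), step t k * ‖e k‖ := by
  have hK0 : 0 ≤ K := le_trans (Finset.sum_nonneg fun _ _ => abs_nonneg _) (hK m hm hmN).1
  have hτ0 : 0 ≤ τ := (hτ m (by omega) hmN).le.trans (hτ' m (by omega) hmN)
  have h := Finset.sum_le_sum fun k (hk : k ∈ Finset.Icc 3 m) =>
    half_norm_sq_sub_le_of_isErrorEquation hτ hτ' hr hK hκ hη he hmax (Finset.mem_Icc.1 hk).1
      (Finset.mem_Icc.1 hk).2 ((Finset.mem_Icc.1 hk).2.trans hmN)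
  rw [← Finset.mul_sum, sum_sub_pred (fun k => ‖e k‖ ^ 2) m (by omega), Finset.sum_add_distrib,
    ← Finset.mul_sum] at h
  simp only [Finset.sum_add_distrib, ← Finset.mul_sum] at h
  rw [sum_step m (by omega)] at h
  have h1 := sum_step_mul_inner_nonpos hτ hr he hm hmN
  have h2 := mul_le_mul_of_nonneg_left (sum_abs_startWeight₁_le hr hK hm hmN)
    (mul_nonneg hτ0 (norm_nonneg (diffQuot t e 1)))
  have h3 := mul_le_mul_of_nonneg_left (sum_abs_startWeight₂_le hr hK hm hmN)
    (mul_nonneg hτ0 (norm_nonneg (diffQuot t e 2)))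
  obtain ⟨l, rfl⟩ : ∃ l, m = l + 1 := ⟨m - 1, by omega⟩
  rw [Finset.sum_Icc_succ_top (by omega) (fun k => step t k * ‖e k‖)] at h
  rw [Nat.add_sub_cancel]
  have hlast : K * κ * (step t (l + 1) * ‖e (l + 1)‖) ≤ 1 / 4 * ‖e (l + 1)‖ := by
    have a1 := mul_le_mul_of_nonneg_left (hτ' (l + 1) (by omega) hmN) (mul_nonneg hK0 hκ)
    have a2 := mul_le_mul_of_nonneg_right a1 (norm_nonneg (e (l + 1)))
    have a3 := mul_le_mul_of_nonneg_right hκτ (norm_nonneg (e (l + 1)))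
    linarith
  have hsum : 0 ≤ ∑ k ∈ Finset.Icc 3 l, step t k * ‖e k‖ :=
    Finset.sum_nonneg fun k hk => mul_nonneg
      (hτ k (by linarith [(Finset.mem_Icc.1 hk).1]) (by linarith [(Finset.mem_Icc.1 hk).2])).le
      (norm_nonneg _)
  have htt : 0 ≤ t (l + 1) - t 2 := by
    rw [← sum_step (l + 1) (by omega)]
    exact Finset.sum_nonneg fun k hk =>
      (hτ k (by linarith [(Finset.mem_Icc.1 hk).1]) (by linarith [(Finset.mem_Icc.1 hk).2])).le
  unfold dataTerm
  -- The case of zero norm is separated because the estimate below divides by `‖e (l + 1)‖`.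
  rcases (norm_nonneg (e (l + 1))).eq_or_lt with h0 | h0
  · rw [← h0]
    positivity
  set M := ‖e (l + 1)‖
  have h2M := hmax 2 le_rfl (by omega)
  set S := ∑ k ∈ Finset.Icc 3 l, step t k * ‖e k‖
  have h4 : K * κ * (S + step t (l + 1) * M) + K * η * (t (l + 1) - t 2) +
      τ * ‖diffQuot t e 2‖ * ∑ k ∈ Finset.Icc 3 (l + 1), |startWeight₂ t k| +
      τ * ‖diffQuot t e 1‖ * ∑ k ∈ Finset.Icc 3 (l + 1), |startWeight₁ t k| ≤
      K * κ * S + 1 / 4 * M + K * η * (t (l + 1) - t 2) +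
        τ * ‖diffQuot t e 2‖ * (3 * K) + τ * ‖diffQuot t e 1‖ * K := by linarith
  have h5 := mul_le_mul_of_nonneg_left h4 h0.le
  have h6 : ‖e 2‖ ^ 2 ≤ M * ‖e 2‖ := by
    rw [sq]
    exact mul_le_mul_of_nonneg_right h2M (norm_nonneg _)
  have h7 : M * (1 / 2 * M) ≤ M * (1 / 2 * ‖e 2‖ + (K * κ * S + 1 / 4 * M +
      K * η * (t (l + 1) - t 2) + τ * ‖diffQuot t e 2‖ * (3 * K) +
        τ * ‖diffQuot t e 1‖ * K)) := by linarith
  linarith [le_of_mul_le_mul_left h7 h0]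

/-- Stability of the BDF3 error equation. -/
theorem norm_le_of_isErrorEquation (hτ : ∀ k, 1 ≤ k → k ≤ N → 0 < step t k)
    (hτ' : ∀ k, 1 ≤ k → k ≤ N → step t k ≤ τ) (hr : RatiosBounded t N) (hK : IsDocBound t N K)
    (hκ : 0 ≤ κ) (hη : 0 ≤ η) (hκτ : 4 * K * κ * τ ≤ 1) (he : IsErrorEquation t N κ η e W F G)
    {n : ℕ} (hn : 3 ≤ n) (hnN : n ≤ N) :
    ‖e n‖ ≤ 2 * dataTerm t K η τ e n * Real.exp (4 * K * κ * (t (n - 1) - t 2)) := by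
  have hK0 : 0 ≤ K := le_trans (Finset.sum_nonneg fun _ _ => abs_nonneg _) (hK n hn hnN).1
  have hτ0 : 0 ≤ τ := (hτ n (by omega) hnN).le.trans (hτ' n (by omega) hnN)
  have hmono : ∀ m, 2 ≤ m → m ≤ n → t m - t 2 ≤ t n - t 2 ∧ 0 ≤ t m - t 2 := by
    intro m hm hmn
    rw [← sum_step m hm, ← sum_step n (by omega)]
    refine ⟨Finset.sum_le_sum_of_subset_of_nonneg (Finset.Icc_subset_Icc le_rfl hmn) ?_,
      Finset.sum_nonneg ?_⟩
    · intro k hk _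
      rw [Finset.mem_Icc] at hk
      exact (hτ k (by omega) (by omega)).le
    · intro k hk
      rw [Finset.mem_Icc] at hk
      exact (hτ k (by omega) (by omega)).le
  have hdata : 0 ≤ dataTerm t K η τ e n := by
    have := (hmono n (by omega) le_rfl).2
    unfold dataTerm
    positivity
  refine le_mul_exp_of_le_add_sum (x := fun k => ‖e k‖) (by positivity) (by positivity)
    (fun k hk hkn => hτ k (by omega) (by omega)) (fun l hl hln => ?_) hn
  have hsum : ∀ s : Finset ℕ, s ⊆ Finset.Icc 3 (l - 1) →
      ∑ k ∈ s, step t k * ‖e k‖ ≤ ∑ k ∈ Finset.Icc 3 (l - 1), step t k * ‖e k‖ := by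
    intro s hs
    refine Finset.sum_le_sum_of_subset_of_nonneg hs fun k hk _ => ?_
    rw [Finset.mem_Icc] at hk
    exact mul_nonneg (hτ k (by omega) (by omega)).le (norm_nonneg _)
  -- The estimate at a maximizing index `m ≤ l` bounds `‖e l‖` too, since the data term and the sum
  -- only grow from `m` to `l`. If `m = 2`, the starting error alone suffices.
  obtain ⟨m, hm, hmax⟩ := Finset.exists_max_image (Finset.Icc 2 l) (fun k => ‖e k‖)
    ⟨2, Finset.mem_Icc.2 ⟨le_rfl, by omega⟩⟩
  rw [Finset.mem_Icc] at hm
  have hlm := hmax l (Finset.mem_Icc.2 ⟨by omega, le_rfl⟩)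
  rcases hm.1.eq_or_lt with rfl | hm3
  · have h0 := hsum ∅ (Finset.empty_subset _)
    have h1 := (hmono n (by omega) le_rfl).2
    have h2 : ‖e 2‖ ≤ dataTerm t K η τ e n := by
      have : 0 ≤ 2 * K * τ * ‖diffQuot t e 1‖ + 6 * K * τ * ‖diffQuot t e 2‖ +
        2 * K * η * (t n - t 2) := by positivity
      unfold dataTerm
      linarith
    rw [Finset.sum_empty] at h0
    have h3 : 0 ≤ 4 * K * κ * ∑ k ∈ Finset.Icc 3 (l - 1), step t k * ‖e k‖ := by positivity
    linarith
  · have h1 := norm_le_of_isMax hτ hτ' hr hK hκ hη hκτ he (m := m)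
      (fun j hj hjm => hmax j (Finset.mem_Icc.2 ⟨hj, hjm.trans hm.2⟩)) hm3 (by omega)
    have h2 := mul_le_mul_of_nonneg_left (hsum (Finset.Icc 3 (m - 1))
      (Finset.Icc_subset_Icc le_rfl (by omega))) (by positivity : 0 ≤ 4 * K * κ)
    have h3 := mul_le_mul_of_nonneg_left (hmono m hm.1 (by omega)).1
      (by positivity : 0 ≤ 2 * K * η)
    have h4 : dataTerm t K η τ e m ≤ dataTerm t K η τ e n := by
      unfold dataTerm
      linarith
    linarith

end Energy

end Stability

/-! ### Taylor expansion of the time derivative -/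

section Taylor

variable {V : Type*} [NormedAddCommGroup V] [NormedSpace ℝ V]

/-- The mean value inequality on `[a, x]`, with the bound frozen at `x`. It loses the factor `1 / (k
+ 1)`, which is harmless here and keeps the same `C` under iteration. -/
theorem norm_sub_le_mul_pow_succ {r r' : ℝ → V} {a b C : ℝ} {k : ℕ} (hC : 0 ≤ C)
    (hr : ∀ x ∈ Icc a b, HasDerivWithinAt r (r' x) (Icc a b) x)
    (h : ∀ x ∈ Icc a b, ‖r' x‖ ≤ C * (x - a) ^ k) {x : ℝ} (hx : x ∈ Icc a b) :
    ‖r x - r a‖ ≤ C * (x - a) ^ (k + 1) := by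
  have hsub : Icc a x ⊆ Icc a b := Icc_subset_Icc le_rfl hx.2
  have := (convex_Icc a x).norm_image_sub_le_of_norm_hasDerivWithin_le (f := r) (f' := r')
    (C := C * (x - a) ^ k) (fun y hy => (hr y (hsub hy)).mono hsub)
    (fun y hy => (h y (hsub hy)).trans (mul_le_mul_of_nonneg_left
      (pow_le_pow_left₀ (by linarith [hy.1]) (by linarith [hy.2]) _) hC))
    (left_mem_Icc.2 hx.1) (right_mem_Icc.2 hx.1)
  rwa [Real.norm_of_nonneg (by linarith [hx.1]), mul_assoc, ← pow_succ] at this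

/-- Second-order Taylor expansion of the derivative of a `C⁴` curve, with a remainder estimate
uniform in the base point. -/
theorem exists_taylor_derivWithin_bound {u : ℝ → V} {T : ℝ} (hT : 0 < T)
    (hu : ContDiffOn ℝ 4 u (Icc 0 T)) :
    ∃ C, 0 < C ∧ ∀ a ∈ Icc 0 T, ∃ g0 g1 g2 : V, ∀ x ∈ Icc a T,
      ‖derivWithin u (Icc 0 T) x - (g0 + (x - a) • g1 + (x - a) ^ 2 • g2)‖ ≤
        C * (x - a) ^ 3 := by
  have hs : UniqueDiffOn ℝ (Icc 0 T) := uniqueDiffOn_Icc hT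
  set g := derivWithin u (Icc 0 T)
  have hg : ContDiffOn ℝ 3 g (Icc 0 T) := hu.derivWithin hs (by norm_num)
  set h := derivWithin g (Icc 0 T)
  have hh : ContDiffOn ℝ 2 h (Icc 0 T) := hg.derivWithin hs (by norm_num)
  set l := derivWithin h (Icc 0 T)
  have hl : ContDiffOn ℝ 1 l (Icc 0 T) := hh.derivWithin hs (by norm_num)
  have hl' : ContinuousOn (derivWithin l (Icc 0 T)) (Icc 0 T) :=
    hl.continuousOn_derivWithin hs le_rfl
  obtain ⟨C₀, hC₀⟩ := isCompact_Icc.exists_bound_of_continuousOn hl'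
  refine ⟨max C₀ 1, by positivity, fun a ha => ⟨g a, h a, (1 / 2 : ℝ) • l a, fun x hx => ?_⟩⟩
  have hsub : Icc a T ⊆ Icc 0 T := Icc_subset_Icc ha.1 le_rfl
  have hC : (0 : ℝ) ≤ max C₀ 1 := by positivity
  have dg : ∀ y ∈ Icc a T, HasDerivWithinAt g (h y) (Icc a T) y := fun y hy =>
    ((hg.differentiableOn (by norm_num)) y (hsub hy)).hasDerivWithinAt.mono hsub
  have dh : ∀ y ∈ Icc a T, HasDerivWithinAt h (l y) (Icc a T) y := fun y hy =>
    ((hh.differentiableOn (by norm_num)) y (hsub hy)).hasDerivWithinAt.mono hsub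
  have dl : ∀ y ∈ Icc a T, HasDerivWithinAt l (derivWithin l (Icc 0 T) y) (Icc a T) y :=
    fun y hy => ((hl.differentiableOn (by norm_num)) y (hsub hy)).hasDerivWithinAt.mono hsub
  have did : ∀ y : ℝ, HasDerivWithinAt (fun y => y - a) 1 (Icc a T) y := fun y =>
    (hasDerivWithinAt_id y _).sub_const a
  have b1 : ∀ y ∈ Icc a T, ‖l y - l a‖ ≤ max C₀ 1 * (y - a) ^ 1 := fun y hy =>
    norm_sub_le_mul_pow_succ (k := 0) hC dl (fun z hz => by
      rw [pow_zero, mul_one]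
      exact (hC₀ z (hsub hz)).trans (le_max_left _ _)) hy
  have b2 : ∀ y ∈ Icc a T, ‖h y - h a - (y - a) • l a‖ ≤ max C₀ 1 * (y - a) ^ 2 := by
    intro y hy
    have := norm_sub_le_mul_pow_succ (k := 1) (r := fun y => h y - (y - a) • l a)
      (r' := fun y => l y - l a) hC
      (fun z hz => ((dh z hz).sub ((did z).smul_const (l a))).congr_deriv (by rw [one_smul]))
      b1 hy
    simp only [sub_self, zero_smul, sub_zero] at this
    rwa [sub_right_comm]
  have b3 := norm_sub_le_mul_pow_succ (k := 2)
    (r := fun y => g y - (y - a) • h a - (y - a) ^ 2 • ((1 / 2 : ℝ) • l a))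
    (r' := fun y => h y - h a - (y - a) • l a) hC
    (fun z hz => by
      refine (((dg z hz).sub ((did z).smul_const (h a))).sub
        (((did z).pow 2).smul_const ((1 / 2 : ℝ) • l a))).congr_deriv ?_
      push_cast
      module) b2 hx
  simp only [sub_self, zero_smul, sub_zero, ne_eq, OfNat.ofNat_ne_zero, not_false_eq_true,
    zero_pow] at b3
  convert b3 using 2
  abel

end Taylor

/-! ### Elementary facts about meshes -/

section Mesh

variable {T : ℝ} {N : ℕ} {t : ℕ → ℝ}

theorem IsMesh.step_pos (h : IsMesh T N t) {k : ℕ} (hk : 1 ≤ k) (hkN : k ≤ N) : 0 < step t k := by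
  have := h.lt (k - 1) (by omega)
  rw [Nat.sub_add_cancel hk] at this
  exact sub_pos.2 this

theorem IsMesh.mono (h : IsMesh T N t) {i j : ℕ} (hij : i ≤ j) (hj : j ≤ N) : t i ≤ t j := by
  induction j, hij using Nat.le_induction with
  | base => exact le_rfl
  | succ j hij ih => exact (ih (by omega)).trans (h.lt j (by omega)).le

theorem IsMesh.mem_Icc (h : IsMesh T N t) {k : ℕ} (hk : k ≤ N) : t k ∈ Icc 0 T :=
  ⟨h.zero ▸ h.mono (Nat.zero_le k) hk, h.last ▸ h.mono hk le_rfl⟩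

theorem step_le_maxStep (t : ℕ → ℝ) {k : ℕ} (hk : 1 ≤ k) (hkN : k ≤ N) :
    step t k ≤ maxStep t N :=
  le_csSup ((finite_Icc 1 N).image _).bddAbove ⟨k, ⟨hk, hkN⟩, rfl⟩

end Mesh

/-! ### Truncation error -/

section Truncation

variable {V : Type*} [NormedAddCommGroup V] [NormedSpace ℝ V] {T : ℝ} {N : ℕ} {t : ℕ → ℝ}

theorem D3_add (v w : ℕ → V) (n : ℕ) : D3 t (fun k => v k + w k) n = D3 t v n + D3 t w n := by
  simp only [D3, diffQuot]
  module

theorem D3_smul_const (q : ℕ → ℝ) (g : V) (n : ℕ) : D3 t (fun k => q k • g) n = D3 t q n • g := by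
  simp only [D3, diffQuot, smul_eq_mul]
  module

/-- Exactness on cubics, stated about the base point `t (n - 3)`, the oldest time level in the
formula; constants are annihilated anyway. -/
theorem D3_pow {n : ℕ} (hn : 3 ≤ n) (h0 : 0 < step t n) (h1 : 0 < step t (n - 1))
    (h2 : 0 < step t (n - 2)) (m : ℕ) (hm : m < 3) :
    D3 t (fun k => (t k - t (n - 3)) ^ (m + 1)) n = (m + 1) * (t n - t (n - 3)) ^ m := by
  obtain ⟨n, rfl⟩ : ∃ l, n = l + 3 := ⟨n - 3, by omega⟩
  simp only [D3, diffQuot, kernel, ratio, smul_eq_mul, Nat.reduceSubDiff, Nat.add_sub_cancel]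
    at h1 h2 ⊢
  obtain ⟨c, hc⟩ : ∃ c, c = step t (n + 1) := ⟨_, rfl⟩
  obtain ⟨b, hb⟩ : ∃ b, b = step t (n + 2) := ⟨_, rfl⟩
  obtain ⟨a, ha⟩ : ∃ a, a = step t (n + 3) := ⟨_, rfl⟩
  rw [← ha] at h0
  rw [← hb] at h1
  rw [← hc] at h2
  simp only [← ha, ← hb, ← hc]
  simp only [step, Nat.reduceSubDiff, Nat.add_sub_cancel] at ha hb hc
  rw [show t (n + 3) = t n + (a + b + c) by linarith, show t (n + 2) = t n + (b + c) by linarith,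
    show t (n + 1) = t n + c by linarith]
  simp only [add_sub_cancel_left, sub_self]
  unfold d0 d1 d2
  interval_cases m
  all_goals
    norm_num
    field_simp
    ring

theorem norm_D3_le (hr : RatiosBounded t N) {v : ℕ → V} {C : ℝ} {n : ℕ} (hn : 3 ≤ n) (hnN : n ≤ N)
    (hv : ∀ k, n ≤ k + 2 → k ≤ n → ‖diffQuot t v k‖ ≤ C) : ‖D3 t v n‖ ≤ 6 * C := by
  have h1 := hr n (by omega) hnN
  have h2 := hr (n - 1) (by omega) (by omega)
  have a0 : |kernel t n 0| ≤ 3 := by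
    rw [abs_of_nonneg (zero_le_one.trans (hr.one_le_kernel hn hnN))]
    exact (d0_le h1.1 h1.2 h2.1 h2.2).trans (by norm_num)
  have a1 := hr.abs_kernel_one_le hn hnN
  have a2 := hr.abs_kernel_two_le hn hnN
  rw [D3]
  refine (norm_add₃_le).trans ?_
  simp only [norm_smul, Real.norm_eq_abs]
  have b0 := mul_le_mul a0 (hv n (by omega) le_rfl) (norm_nonneg _) (by norm_num)
  have b1 := mul_le_mul a1 (hv (n - 1) (by omega) (by omega)) (norm_nonneg _) (by norm_num)
  have b2 := mul_le_mul a2 (hv (n - 2) (by omega) (by omega)) (norm_nonneg _) (by norm_num)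
  linarith

/-- The BDF3 formula is third-order accurate, uniformly in the mesh. -/
theorem exists_truncation_bound {u : ℝ → V} (hT : 0 < T) (hu : ContDiffOn ℝ 4 u (Icc 0 T)) :
    ∃ C, 0 < C ∧ ∀ (N : ℕ) (t : ℕ → ℝ), IsMesh T N t → RatiosBounded t N →
      ∀ j, 3 ≤ j → j ≤ N →
        ‖D3 t (fun k => u (t k)) j - derivWithin u (Icc 0 T) (t j)‖ ≤ C * maxStep t N ^ 3 := by
  obtain ⟨C, hC, hCt⟩ := exists_taylor_derivWithin_bound hT hu
  -- The three levels span at most `3τ`, so the derivative remainder is at most `27 C τ³`. It enters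
  -- six times through `norm_D3_le` and once directly at `t j`, and `7 * 27 = 189`.
  refine ⟨189 * C, by positivity, fun N t ht hr j hj hjN => ?_⟩
  set a := t (j - 3) with ha
  have haT : a ∈ Icc 0 T := ht.mem_Icc (by omega)
  obtain ⟨g0, g1, g2, hg⟩ := hCt a haT
  have hsub : Icc a (t j) ⊆ Icc a T := Icc_subset_Icc le_rfl (ht.mem_Icc hjN).2
  have hsub' : Icc a (t j) ⊆ Icc 0 T := Icc_subset_Icc haT.1 (ht.mem_Icc hjN).2
  have hstep := fun k (hk : 1 ≤ k) (hkN : k ≤ N) => step_le_maxStep t hk hkN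
  have hlen : t j - a ≤ 3 * maxStep t N := by
    have h0 := hstep j (by omega) hjN
    have h1 := hstep (j - 1) (by omega) (by omega)
    have h2 := hstep (j - 2) (by omega) (by omega)
    simp only [step, Nat.sub_sub, Nat.reduceAdd] at h0 h1 h2
    linarith
  have hcube : ∀ x ∈ Icc a (t j), C * (x - a) ^ 3 ≤ C * (27 * maxStep t N ^ 3) := by
    intro x hx
    refine mul_le_mul_of_nonneg_left ?_ hC.le
    refine (pow_le_pow_left₀ (a := x - a) (b := 3 * maxStep t N) (by linarith [hx.1])
      (by linarith [hx.2]) 3).trans_eq (by ring)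
  -- The subtracted cubic is the antiderivative of the Taylor polynomial of `u'`. The constant `u a`
  -- stays in `R`, where the difference quotients remove it.
  set R : ℝ → V := fun x => u x - ((x - a) ^ 1 • g0 + (x - a) ^ 2 • ((1 / 2 : ℝ) • g1) +
    (x - a) ^ 3 • ((1 / 3 : ℝ) • g2)) with hR
  have hRd : ∀ x ∈ Icc a (t j), HasDerivWithinAt R (derivWithin u (Icc 0 T) x -
      (g0 + (x - a) • g1 + (x - a) ^ 2 • g2)) (Icc a (t j)) x := by
    intro x hx
    have d0 : HasDerivWithinAt u (derivWithin u (Icc 0 T) x) (Icc a (t j)) x :=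
      ((hu.differentiableOn (by norm_num)) x (hsub' hx)).hasDerivWithinAt.mono hsub'
    have did : HasDerivWithinAt (fun y => y - a) 1 (Icc a (t j)) x :=
      (hasDerivWithinAt_id x _).sub_const a
    refine (d0.sub ((((did.pow 1).smul_const g0).add
      ((did.pow 2).smul_const ((1 / 2 : ℝ) • g1))).add
        ((did.pow 3).smul_const ((1 / 3 : ℝ) • g2)))).congr_deriv ?_
    push_cast
    module
  have hdiff : ∀ k, j ≤ k + 2 → k ≤ j → ‖diffQuot t (fun k => R (t k)) k‖ ≤
      C * (27 * maxStep t N ^ 3) := by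
    intro k hk hkj
    have hpos := ht.step_pos (k := k) (by omega) (by omega)
    have hm := (convex_Icc a (t j)).norm_image_sub_le_of_norm_hasDerivWithin_le hRd
      (fun x hx => (hg x (hsub hx)).trans (hcube x hx))
      (x := t (k - 1)) (y := t k) ⟨ht.mono (by omega) (by omega), ht.mono (by omega) hjN⟩
      ⟨ht.mono (by omega) (by omega), ht.mono hkj hjN⟩
    rw [diffQuot, norm_smul, norm_inv, Real.norm_of_nonneg hpos.le, inv_mul_le_iff₀ hpos, mul_comm]
    rwa [← step, Real.norm_of_nonneg hpos.le] at hm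
  have hD : D3 t (fun k => u (t k)) j =
      (g0 + (t j - a) • g1 + (t j - a) ^ 2 • g2) + D3 t (fun k => R (t k)) j := by
    have hsplit : (fun k => u (t k)) = fun k => ((t k - a) ^ (0 + 1) • g0 +
        (t k - a) ^ (1 + 1) • ((1 / 2 : ℝ) • g1) +
          (t k - a) ^ (2 + 1) • ((1 / 3 : ℝ) • g2)) + R (t k) := by
      funext k
      simp only [hR]
      abel
    rw [hsplit, D3_add, D3_add, D3_add, D3_smul_const, D3_smul_const, D3_smul_const]
    have hp := D3_pow hj (ht.step_pos (by omega) hjN) (ht.step_pos (by omega) (by omega))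
      (ht.step_pos (by omega) (by omega))
    rw [ha, hp 0 (by norm_num), hp 1 (by norm_num), hp 2 (by norm_num)]
    push_cast
    module
  have hj0 : t j ∈ Icc a (t j) := ⟨ht.mono (by omega) hjN, le_rfl⟩
  have h1 := norm_D3_le hr hj hjN hdiff
  have h2 := (hg (t j) (hsub hj0)).trans (hcube (t j) hj0)
  rw [hD]
  have h3 := norm_sub_le (D3 t (fun k => R (t k)) j)
    (derivWithin u (Icc 0 T) (t j) - (g0 + (t j - a) • g1 + (t j - a) ^ 2 • g2))
  rw [show D3 t (fun k => R (t k)) j - (derivWithin u (Icc 0 T) (t j) -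
    (g0 + (t j - a) • g1 + (t j - a) ^ 2 • g2)) = (g0 + (t j - a) • g1 + (t j - a) ^ 2 • g2) +
      D3 t (fun k => R (t k)) j - derivWithin u (Icc 0 T) (t j) by abel] at h3
  linarith

end Truncation

/-! ### Weak gradients, weak divergences and Green's formula -/

section Sobolev

variable {d : ℕ} {Ω : TopologicalSpace.Opens (E d)}

theorem gradient_sub {f g : E d → ℝ} {x : E d} (hf : DifferentiableAt ℝ f x)
    (hg : DifferentiableAt ℝ g x) : gradient (f - g) x = gradient f x - gradient g x := by
  simp only [gradient, fderiv_sub hf hg, map_sub]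

theorem testFunction_contDiff (φ : 𝓓(Ω, ℝ)) : ContDiff ℝ 1 φ :=
  φ.contDiff.of_le (by norm_cast)

theorem continuous_gradient_testFunction (φ : 𝓓(Ω, ℝ)) : Continuous (gradient φ) :=
  (InnerProductSpace.toDual ℝ (E d)).symm.continuous.comp
    ((testFunction_contDiff φ).continuous_fderiv (by norm_num))

theorem hasCompactSupport_gradient_testFunction (φ : 𝓓(Ω, ℝ)) :
    HasCompactSupport (gradient φ) :=
  (φ.hasCompactSupport.fderiv (𝕜 := ℝ)).comp_left
    (g := (InnerProductSpace.toDual ℝ (E d)).symm) (map_zero _)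

theorem memLp_testFunction (φ : 𝓓(Ω, ℝ)) : MemLp φ 2 (volume.restrict (Ω : Set (E d))) :=
  φ.continuous.memLp_of_hasCompactSupport φ.hasCompactSupport

theorem memLp_gradient_testFunction (φ : 𝓓(Ω, ℝ)) :
    MemLp (gradient φ) 2 (volume.restrict (Ω : Set (E d))) :=
  (continuous_gradient_testFunction φ).memLp_of_hasCompactSupport
    (hasCompactSupport_gradient_testFunction φ)

theorem tendsto_eLpNorm_sub {F : Type*} [NormedAddCommGroup F] {μ : Measure (E d)}
    {p q : ℕ → E d → F} {v w : Lp F 2 μ} (hp : ∀ m, AEStronglyMeasurable (p m) μ)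
    (hq : ∀ m, AEStronglyMeasurable (q m) μ)
    (hpv : Tendsto (fun m => eLpNorm (fun x => p m x - v x) 2 μ) atTop (𝓝 0))
    (hqw : Tendsto (fun m => eLpNorm (fun x => q m x - w x) 2 μ) atTop (𝓝 0)) :
    Tendsto (fun m => eLpNorm (fun x => (p m x - q m x) - (v - w) x) 2 μ) atTop (𝓝 0) := by
  have h := hpv.add hqw
  rw [add_zero] at h
  refine tendsto_of_tendsto_of_tendsto_of_le_of_le tendsto_const_nhds h (fun _ => zero_le)
    fun m => ?_
  have e : (fun x => (p m x - q m x) - (v - w) x) =ᵐ[μ]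
      (fun x => p m x - v x) - fun x => q m x - w x := by
    filter_upwards [Lp.coeFn_sub v w] with x hx
    simp only [hx, Pi.sub_apply]
    abel
  simp only
  rw [eLpNorm_congr_ae e]
  exact eLpNorm_sub_le ((hp m).sub (Lp.aestronglyMeasurable v))
    ((hq m).sub (Lp.aestronglyMeasurable w)) (by norm_num)

theorem HasH10Gradient.sub {v₁ v₂ : L2 Ω} {g₁ g₂ : L2Vec Ω} (h₁ : HasH10Gradient Ω v₁ g₁)
    (h₂ : HasH10Gradient Ω v₂ g₂) : HasH10Gradient Ω (v₁ - v₂) (g₁ - g₂) := by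
  obtain ⟨φ, hφ, hφ'⟩ := h₁
  obtain ⟨ψ, hψ, hψ'⟩ := h₂
  refine ⟨fun m => φ m - ψ m, ?_, ?_⟩
  · exact tendsto_eLpNorm_sub (fun m => (memLp_testFunction (φ m)).1)
      (fun m => (memLp_testFunction (ψ m)).1) hφ hψ
  · have := tendsto_eLpNorm_sub (fun m => (memLp_gradient_testFunction (φ m)).1)
      (fun m => (memLp_gradient_testFunction (ψ m)).1) hφ' hψ'
    refine this.congr fun m => ?_
    congr 1
    funext x
    have hd := fun χ : 𝓓(Ω, ℝ) => (testFunction_contDiff χ).differentiable (by norm_num) x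
    rw [← gradient_sub (hd (φ m)) (hd (ψ m))]
    rfl

/-- `g` has weak divergence `w`. -/
def HasWeakDivergence (Ω : TopologicalSpace.Opens (E d)) (g : L2Vec Ω) (w : L2 Ω) : Prop :=
  ∀ φ : 𝓓(Ω, ℝ), ∫ x in (Ω : Set (E d)), inner ℝ (g x) (gradient φ x) =
    -∫ x in (Ω : Set (E d)), w x * φ x

theorem inner_toLp_eq_integral {F : Type*} [NormedAddCommGroup F] [InnerProductSpace ℝ F]
    {μ : Measure (E d)} (v : Lp F 2 μ) {p : E d → F} (hp : MemLp p 2 μ) :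
    inner ℝ v (hp.toLp p) = ∫ x, inner ℝ (v x) (p x) ∂μ := by
  rw [L2.inner_def]
  refine integral_congr_ae ?_
  filter_upwards [hp.coeFn_toLp] with x hx
  rw [hx]

theorem hasWeakDivergence_iff {g : L2Vec Ω} {w : L2 Ω} :
    HasWeakDivergence Ω g w ↔ ∀ φ : 𝓓(Ω, ℝ),
      inner ℝ g ((memLp_gradient_testFunction φ).toLp (gradient φ)) =
        -inner ℝ w ((memLp_testFunction φ).toLp φ) := by
  simp only [inner_toLp_eq_integral, HasWeakDivergence]
  simp only [RCLike.inner_apply, conj_trivial, mul_comm]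

theorem HasWeakDivergence.sub {g₁ g₂ : L2Vec Ω} {w₁ w₂ : L2 Ω} (h₁ : HasWeakDivergence Ω g₁ w₁)
    (h₂ : HasWeakDivergence Ω g₂ w₂) : HasWeakDivergence Ω (g₁ - g₂) (w₁ - w₂) := by
  rw [hasWeakDivergence_iff] at *
  intro φ
  rw [inner_sub_left, inner_sub_left, h₁, h₂]
  ring

theorem HasDirichletLaplacian.sub {v₁ v₂ w₁ w₂ : L2 Ω} (h₁ : HasDirichletLaplacian Ω v₁ w₁)
    (h₂ : HasDirichletLaplacian Ω v₂ w₂) : HasDirichletLaplacian Ω (v₁ - v₂) (w₁ - w₂) := by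
  obtain ⟨g₁, hg₁, hw₁⟩ := h₁
  obtain ⟨g₂, hg₂, hw₂⟩ := h₂
  exact ⟨g₁ - g₂, hg₁.sub hg₂, HasWeakDivergence.sub hw₁ hw₂⟩

/-- Green's formula in `H¹₀`. -/
theorem HasWeakDivergence.inner_eq {v : L2 Ω} {g g' : L2Vec Ω} {w : L2 Ω}
    (hw : HasWeakDivergence Ω g w) (hv : HasH10Gradient Ω v g') :
    inner ℝ w v = -inner ℝ g g' := by
  rw [hasWeakDivergence_iff] at hw
  obtain ⟨φ, hφ, hφ'⟩ := hv
  -- The weak divergence identity holds for each test function, and both sides are continuous under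
  -- the `L²` convergence of the functions and their gradients.
  have h1 : Tendsto (fun m => (memLp_testFunction (φ m)).toLp (φ m)) atTop (𝓝 v) := by
    rw [Lp.tendsto_Lp_iff_tendsto_eLpNorm']
    refine hφ.congr fun m => eLpNorm_congr_ae ?_
    filter_upwards [(memLp_testFunction (φ m)).coeFn_toLp] with x hx
    rw [Pi.sub_apply, hx]
  have h2 : Tendsto (fun m => (memLp_gradient_testFunction (φ m)).toLp (gradient (φ m))) atTop
      (𝓝 g') := by
    rw [Lp.tendsto_Lp_iff_tendsto_eLpNorm']
    refine hφ'.congr fun m => eLpNorm_congr_ae ?_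
    filter_upwards [(memLp_gradient_testFunction (φ m)).coeFn_toLp] with x hx
    rw [Pi.sub_apply, hx]
  have h3 := (tendsto_const_nhds (x := w)).inner (𝕜 := ℝ) h1
  have h4 := ((tendsto_const_nhds (x := g)).inner (𝕜 := ℝ) h2).neg
  refine tendsto_nhds_unique h3 (h4.congr fun m => ?_)
  rw [hw, neg_neg]

end Sobolev

/-! ### The error equation of the BDF3 scheme -/

theorem D3_sub {V : Type*} [AddCommGroup V] [Module ℝ V] (t : ℕ → ℝ) (v w : ℕ → V) (n : ℕ) :
    D3 t (fun k => v k - w k) n = D3 t v n - D3 t w n := by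
  simp only [D3, diffQuot]
  module

/-- In the difference of the equation and the scheme `f` cancels. `W` is `ε` times the weak
Laplacian of the error, `F` collects the reaction and truncation terms, and `G` is `√ε` times the
weak gradient, so Green's formula yields the Gram identity. -/
theorem exists_isErrorEquation {d : ℕ} {Ω : TopologicalSpace.Opens (E d)} {T ε κs η : ℝ}
    {κ : E d → ℝ} {f : ℝ → E d → ℝ} {u₀ : L2 Ω} {u : ℝ → L2 Ω} {N : ℕ} {t : ℕ → ℝ}
    {U : ℕ → L2 Ω} (hε : 0 ≤ ε) (hκ : ∀ x ∈ Ω, |κ x| ≤ κs) (hu : IsSolution Ω T ε κ f u₀ u)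
    (hU : IsBDF3Solution Ω ε κ f t N U) (ht : IsMesh T N t)
    (hη : ∀ j, 3 ≤ j → j ≤ N →
      ‖D3 t (fun k => u (t k)) j - derivWithin u (Icc 0 T) (t j)‖ ≤ η) :
    ∃ (W F : ℕ → L2 Ω) (G : ℕ → L2Vec Ω), IsErrorEquation t N κs η (err u t U) W F G := by
  have key : ∀ k, ∃ (w : L2 Ω) (g : L2Vec Ω), 3 ≤ k → k ≤ N →
      HasH10Gradient Ω (err u t U k) g ∧ HasWeakDivergence Ω g w ∧
        ‖D3 t (err u t U) k - ε • w‖ ≤ κs * ‖err u t U k‖ + η := by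
    intro k
    by_cases hk : 3 ≤ k ∧ k ≤ N
    swap
    · exact ⟨0, 0, fun h h' => absurd ⟨h, h'⟩ hk⟩
    obtain ⟨hk, hkN⟩ := hk
    have htk : t k ∈ Ioc 0 T := by
      refine ⟨?_, (ht.mem_Icc hkN).2⟩
      have h0 := ht.step_pos (k := k) (by omega) hkN
      have h1 := (ht.mem_Icc (k := k - 1) (by omega)).1
      rw [step] at h0
      linarith
    obtain ⟨w₁, hw₁, hpde⟩ := hu.pde (t k) htk
    obtain ⟨w₂, hw₂, hbdf⟩ := hU k hk hkN
    obtain ⟨g, hg, hgw⟩ := hw₁.sub hw₂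
    refine ⟨w₁ - w₂, g, fun _ _ => ⟨hg, hgw, ?_⟩⟩
    -- Subtracting the scheme from the equation pointwise shows that `r` is `κ` times the error.
    set r : L2 Ω := derivWithin u (Icc 0 T) (t k) - D3 t U k - ε • (w₁ - w₂) with hr
    have hr' : ‖r‖ ≤ κs * ‖err u t U k‖ := by
      refine Lp.norm_le_mul_norm_of_ae_le_mul ?_
      filter_upwards [hpde, hbdf, Lp.coeFn_sub (derivWithin u (Icc 0 T) (t k) - D3 t U k)
        (ε • (w₁ - w₂)), Lp.coeFn_sub (derivWithin u (Icc 0 T) (t k)) (D3 t U k),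
        Lp.coeFn_smul ε (w₁ - w₂), Lp.coeFn_sub w₁ w₂, Lp.coeFn_sub (u (t k)) (U k),
        ae_restrict_mem Ω.isOpen.measurableSet] with x h1 h2 h3 h4 h5 h6 h7 hx
      rw [err, hr, h3, h7, Pi.sub_apply, h4, h5, Pi.sub_apply, Pi.smul_apply, h6, Pi.sub_apply,
        Pi.sub_apply, smul_eq_mul]
      rw [show derivWithin u (Icc 0 T) (t k) x - D3 t U k x - ε * (w₁ x - w₂ x) =
        κ x * (u (t k) x - U k x) by linarith, norm_mul]
      exact mul_le_mul_of_nonneg_right (hκ x hx) (norm_nonneg _)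
    have hsplit : D3 t (err u t U) k - ε • (w₁ - w₂) =
        r + (D3 t (fun k => u (t k)) k - derivWithin u (Icc 0 T) (t k)) := by
      have : D3 t (err u t U) k = D3 t (fun k => u (t k)) k - D3 t U k :=
        D3_sub t (fun k => u (t k)) U k
      rw [this, hr]
      abel
    rw [hsplit]
    exact (norm_add_le _ _).trans (add_le_add hr' (hη k hk hkN))
  choose w g h using key
  refine ⟨fun k => ε • w k, fun k => D3 t (err u t U) k - ε • w k, fun k => Real.sqrt ε • g k,
    fun k _ _ => by abel, fun j k hj hjN hk hkN => ?_, fun k hk hkN => (h k hk hkN).2.2⟩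
  rw [real_inner_smul_left, real_inner_smul_left, real_inner_smul_right, ← mul_assoc,
    Real.mul_self_sqrt hε, (h j hj hjN).2.1.inner_eq (h k hk hkN).1]
  ring

end BDF3

end

/-! ### Assembly of the main theorem -/

theorem mainTheorem6 :
    ∃ K₃ : ℝ, 0 < K₃ ∧
      -- `K₃` bounds the DOC kernel sums of every admissible mesh
      (∀ (T : ℝ) (N : ℕ) (t : ℕ → ℝ), BDF3.IsMesh T N t → BDF3.RatiosAdmissible t N →
        BDF3.IsDocBound t N K₃) ∧
      ∀ (d : ℕ) (Ω : TopologicalSpace.Opens (BDF3.E d)),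
        Bornology.IsBounded (Ω : Set (BDF3.E d)) → Convex ℝ (Ω : Set (BDF3.E d)) →
        ∀ (T : ℝ) (u : ℝ → BDF3.L2 Ω), 0 < T → ContDiffOn ℝ 4 u (Icc 0 T) →
          ∃ Kᵤ : ℝ, 0 < Kᵤ ∧
            ∀ (N : ℕ) (t : ℕ → ℝ), BDF3.IsMesh T N t → BDF3.RatiosAdmissible t N →
              -- third-order truncation error
              (∀ j, 3 ≤ j → j ≤ N →
                ‖BDF3.D3 t (fun k => u (t k)) j - derivWithin u (Icc 0 T) (t j)‖
                  ≤ Kᵤ * BDF3.maxStep t N ^ 3) ∧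
              ∀ (ε κs : ℝ) (κ : BDF3.E d → ℝ) (f : ℝ → BDF3.E d → ℝ) (u₀ : BDF3.L2 Ω),
                0 < ε → 0 < κs → ContDiffOn ℝ ∞ κ (Ω : Set (BDF3.E d)) →
                (∀ x ∈ Ω, |κ x| ≤ κs) →
                BDF3.IsSolution Ω T ε κ f u₀ u →
                BDF3.maxStep t N ≤ 1 / (4 * K₃ * κs) →
                ∀ U : ℕ → BDF3.L2 Ω, BDF3.IsBDF3Solution Ω ε κ f t N U →
                  ∀ n, 3 ≤ n → n ≤ N →
                    ‖BDF3.err u t U n‖ ≤ 2 * Real.exp (4 * K₃ * κs * t (n - 1)) *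
                      (‖BDF3.err u t U 2‖
                        + K₃ * BDF3.maxStep t N *
                            ‖BDF3.diffQuot t (BDF3.err u t U) 1‖
                        + 4 * K₃ * BDF3.maxStep t N *
                            ‖BDF3.diffQuot t (BDF3.err u t U) 2‖
                        + 2 * K₃ * Kᵤ * t n * BDF3.maxStep t N ^ 3) := by
  -- The kernel sums are bounded by 20. The stability estimate with `K = 20` carries `2K` before the
  -- first difference quotient and `6K` before the second, so `K₃ = 2K = 40` covers both `K₃` and
  -- `4K₃`.
  refine ⟨40, by norm_num, fun T N t _ hr => hr.bounded.isDocBound.mono (by norm_num), ?_⟩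
  intro d Ω _ _ T u hT hu
  obtain ⟨C, hC, htrunc⟩ := BDF3.exists_truncation_bound hT hu
  refine ⟨C, hC, fun N t ht hr => ⟨htrunc N t ht hr.bounded, ?_⟩⟩
  intro ε κs κ f u₀ hε hκs _ hκ hsol hτ U hU n hn hnN
  obtain ⟨W, F, G, he⟩ := BDF3.exists_isErrorEquation hε.le hκ hsol hU ht
    (htrunc N t ht hr.bounded)
  have hstep := fun k (hk : 1 ≤ k) (hkN : k ≤ N) => BDF3.step_le_maxStep t hk hkN
  have hτ0 : 0 ≤ BDF3.maxStep t N :=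
    (ht.step_pos (k := n) (by omega) hnN).le.trans (hstep n (by omega) hnN)
  have hκτ : 4 * 20 * κs * BDF3.maxStep t N ≤ 1 := by
    rw [le_div_iff₀ (by positivity)] at hτ
    have : 0 ≤ κs * BDF3.maxStep t N := by positivity
    linarith
  have h := BDF3.norm_le_of_isErrorEquation (fun k hk hkN => ht.step_pos hk hkN) hstep hr.bounded
    hr.bounded.isDocBound hκs.le (by positivity) hκτ he hn hnN
  have h2 := (ht.mem_Icc (k := 2) (by omega)).1
  have hn0 := (ht.mem_Icc hnN).1
  have hn1 := (ht.mem_Icc (k := n - 1) (by omega)).1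
  have hexp : Real.exp (4 * 20 * κs * (t (n - 1) - t 2)) ≤
      Real.exp (4 * 40 * κs * t (n - 1)) := by
    refine Real.exp_le_exp.2 ?_
    have a1 : 0 ≤ κs * t (n - 1) := by positivity
    have a2 : 0 ≤ κs * t 2 := by positivity
    linarith
  have hdata : BDF3.dataTerm t 20 (C * BDF3.maxStep t N ^ 3) (BDF3.maxStep t N)
      (BDF3.err u t U) n ≤ ‖BDF3.err u t U 2‖
        + 40 * BDF3.maxStep t N * ‖BDF3.diffQuot t (BDF3.err u t U) 1‖
        + 4 * 40 * BDF3.maxStep t N * ‖BDF3.diffQuot t (BDF3.err u t U) 2‖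
        + 2 * 40 * C * t n * BDF3.maxStep t N ^ 3 := by
    have a1 : 0 ≤ BDF3.maxStep t N * ‖BDF3.diffQuot t (BDF3.err u t U) 2‖ := by positivity
    have a2 : 0 ≤ C * BDF3.maxStep t N ^ 3 * t n := by positivity
    have a3 : 0 ≤ C * BDF3.maxStep t N ^ 3 * t 2 := by positivity
    unfold BDF3.dataTerm
    linarith
  rw [mul_right_comm] at h
  exact h.trans ((mul_le_mul_of_nonneg_left hdata (by positivity)).trans
    (mul_le_mul_of_nonneg_right (mul_le_mul_of_nonneg_left hexp zero_le_two) (by positivity)))
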